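/- Let $d\ge 0$ and $\ell\ge 1$ be integers and write $\underline{m}=\{1,\dots,m\}$. Let $\mathcal{G}=\mathcal{G}_{(\ell,d)}$ be the groupoid whose objects are the maps $f:\underline{d}\to\underline{\ell}$ and whose morphisms $f\to g$ are the bijections $\sigma:\underline{d}\to\underline{d}$ with $g\circ\sigma=f$, with composition of maps. Let $\mathbb{C}\mathcal{G}$ be the $\mathbb{C}$-linear category generated by $\mathcal{G}$; a $\mathbb{C}\mathcal{G}$-module is a $\mathbb{C}$-linear functor from $\mathbb{C}\mathcal{G}$ to complex vector spaces. The type of $f$ is $(|f^{-1}(1)|,\dots,|f^{-1}(\ell)|)$. Let $\mathbf{p}=(p_1,\dots,p_\ell)$ be an $\ell$-multi-partition of $d$, i.e. $p_i\vdash\lambda_i$ with $\lambda_1+\dots+\lambda_\ell=d$, and let $\boldsymbol\lambda=(\lambda_1,\dots,\lambda_\ell)$. Let $\mathscr{S}_{\mathbf p}=\mathscr{S}_{p_1}\otimes\dots\otimes\mathscr{S}_{p_\ell}$ be the tensor product of Specht modules, a module over $S_{\boldsymbol\lambda}=S_{\lambda_1}\times\dots\times S_{\lambda_\ell}$. The simple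 $\mathbb{C}\mathcal{G}$-module $\mathrm{L}_{\mathbf p}$ is defined by $\mathrm{L}_{\mathbf p}(f)=\mathscr{S}_{\mathbf p}$ if $f$ has type $\boldsymbol\lambda$ and $\mathrm{L}_{\mathbf p}(f)=0$ otherwise; a morphism $\pi:f\to g$ between objects of type $\boldsymbol\lambda$ acts as the element of $S_{\boldsymbol\lambda}$ obtained from the bijections $f^{-1}(i)\to g^{-1}(i)$ induced by $\pi$ via the order preserving identifications of $f^{-1}(i)$ and $g^{-1}(i)$ with $\underline{\lambda_i}$. Let $\mathbf{k}=(k_1,\dots,k_\ell)$ with all $k_i\geq 1$, let $n=k_1+\dots+k_\ell$ and $V=\mathbb{C}^n=V_1\oplus\dots\oplus V_\ell$, where $V_i$ is spanned by the standard basis vectors $v_j$ with $k_1+\dots+k_{i-1}<j\le k_1+\dots+k_i$. The space $V^{\otimes d}=\bigoplus_f V_{f(1)}\otimes\dots\otimes V_{f(d)}$ is a $\mathbb{C}\mathcal{G}$-module $\mathrm{G}$ with $\mathrm{G}(f)=V_{f(1)}\otimes\dots\otimes V_{f(d)}$, on which $\sigma:f\to g$ acts by $\sigma(w_1\otimes\dots\otimes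 w_d)=w_{\sigma^{-1}(1)}\otimes\dots\otimes w_{\sigma^{-1}(d)}$. The ideal of $\mathbb{C}\mathcal{G}$ corresponding to a family of simple modules is the sum, in the left regular module $\bigoplus_f\mathbb{C}\mathcal{G}(f,-)$, of the images of all homomorphisms from members of the family to the representable modules $\mathbb{C}\mathcal{G}(f,-)$, that is, the sum of the corresponding isotypic components. **Lemma.** The kernel of the action of $\mathbb{C}\mathcal{G}_{(\ell,d)}$ on $V^{\otimes d}$, i.e. the ideal formed by all morphisms $a$ of $\mathbb{C}\mathcal{G}_{(\ell,d)}$ with $\mathrm{G}(a)=0$, is the ideal of $\mathbb{C}\mathcal{G}_{(\ell,d)}$ corresponding to all modules $\mathrm{L}_{\mathbf p}$, where $\mathbf p$ is an $\ell$-multi-partition of $d$ such that for some $i\in\{1,\dots,\ell\}$ the partition $p_i$ has more than $k_i$ rows. -/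

import Mathlib

open CategoryTheory
open scoped TensorProduct

noncomputable section

/-! ### Two-sided ideals of linear categories -/

/-- A two-sided ideal of a `ℂ`-linear category `C`: a family of subspaces of the morphism spaces
which is stable under composition with arbitrary morphisms on both sides. -/
@[ext]
structure LinIdeal (C : Type) [Category.{0} C] [Preadditive C] [Linear ℂ C] where
  carrier : ∀ X Y : C, Submodule ℂ (X ⟶ Y)
  precomp_mem : ∀ {X Y Z : C} (a : X ⟶ Y) {b : Y ⟶ Z}, b ∈ carrier Y Z → a ≫ b ∈ carrier X Z
  postcomp_mem : ∀ {X Y Z : C} {a : X ⟶ Y} (b : Y ⟶ Z), a ∈ carrier X Y → a ≫ b ∈ carrier X Z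

/-- The kernel of the action of `C` on a module `F` over it, that is on a `ℂ`-linear functor to
complex vector spaces: all morphisms which act by zero. -/
def kernelIdeal {C : Type} [Category.{0} C] [Preadditive C] [Linear ℂ C]
    (F : C ⥤ ModuleCat.{0} ℂ) [F.Additive] [F.Linear ℂ] : LinIdeal C where
  carrier X Y := LinearMap.ker (F.mapLinearMap ℂ : (X ⟶ Y) →ₗ[ℂ] (F.obj X ⟶ F.obj Y))
  precomp_mem {X Y Z} a {b} hb := by
    have hb' : F.map b = 0 := hb
    change F.map (a ≫ b) = 0
    rw [F.map_comp, hb', Limits.comp_zero]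
  postcomp_mem {X Y Z} {a} b ha := by
    have ha' : F.map a = 0 := ha
    change F.map (a ≫ b) = 0
    rw [F.map_comp, ha', Limits.zero_comp]

/-- The ideal of `C` corresponding to a family `L` of `C`-modules: the sum of the images of all
homomorphisms from the modules `L i` to the (left) regular module, which is the direct sum of the
representable modules `C(X, -)`. A nonzero homomorphism from a simple module is injective, so for
simple `L i` this is the sum of all submodules of the regular module that are isomorphic to one of
the `L i`, i.e. the sum of the isotypic components of types `L i`. -/
def moduleIdeal {C : Type} [Category.{0} C] [Preadditive C] [Linear ℂ C] {ι : Type}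
    (L : ι → (C ⥤ ModuleCat.{0} ℂ)) : LinIdeal C where
  carrier X Y :=
    ⨆ (i : ι) (φ : L i ⟶ (linearCoyoneda ℂ C).obj (Opposite.op X)),
      (LinearMap.range (φ.app Y).hom : Submodule ℂ (X ⟶ Y))
  precomp_mem {X Y Z} a {b} hb := by
    have key : (⨆ (i : ι) (φ : L i ⟶ (linearCoyoneda ℂ C).obj (Opposite.op Y)),
        (LinearMap.range (φ.app Z).hom : Submodule ℂ (Y ⟶ Z))) ≤
        (⨆ (i : ι) (φ : L i ⟶ (linearCoyoneda ℂ C).obj (Opposite.op X)),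
        (LinearMap.range (φ.app Z).hom : Submodule ℂ (X ⟶ Z))).comap (Linear.leftComp ℂ Z a) := by
      refine iSup_le fun i => iSup_le fun φ => ?_
      rintro _ ⟨y, rfl⟩
      exact Submodule.mem_iSup_of_mem i (Submodule.mem_iSup_of_mem
        (φ ≫ (linearCoyoneda ℂ C).map a.op) ⟨y, rfl⟩)
    exact key hb
  postcomp_mem {X Y Z} {a} b ha := by
    have key : (⨆ (i : ι) (φ : L i ⟶ (linearCoyoneda ℂ C).obj (Opposite.op X)),
        (LinearMap.range (φ.app Y).hom : Submodule ℂ (X ⟶ Y))) ≤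
        (⨆ (i : ι) (φ : L i ⟶ (linearCoyoneda ℂ C).obj (Opposite.op X)),
        (LinearMap.range (φ.app Z).hom : Submodule ℂ (X ⟶ Z))).comap (Linear.rightComp ℂ X b) := by
      refine iSup_le fun i => iSup_le fun φ => ?_
      rintro _ ⟨y, rfl⟩
      refine Submodule.mem_iSup_of_mem i (Submodule.mem_iSup_of_mem φ ⟨((L i).map b).hom y, ?_⟩)
      exact congrArg (fun h => h.hom y) (φ.naturality b)
    exact key ha

/-- The `ℂ`-linear extension of a functor on a category `C` to the `ℂ`-linear category generated
by `C`. -/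
def linExtend {C : Type} [Category.{0} C] (F : C ⥤ ModuleCat.{0} ℂ) :
    CategoryTheory.Free ℂ C ⥤ ModuleCat.{0} ℂ where
  obj X := F.obj X
  map {X Y} a := Finsupp.linearCombination ℂ (fun σ : (show C from X) ⟶ (show C from Y) => F.map σ) a
  map_id X := by
    refine (Finsupp.linearCombination_single ℂ _ _).trans ?_
    rw [one_smul]
    exact F.map_id X
  map_comp {X Y Z} a b := by
    induction a using Finsupp.induction_linear with
    | zero =>
      refine (congrArg _ Limits.zero_comp).trans ?_
      simp
    | add a₁ a₂ h₁ h₂ =>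
      refine (congrArg _ (Preadditive.add_comp (C := CategoryTheory.Free ℂ C) _ _ _ a₁ a₂ b)).trans ?_
      rw [map_add, map_add, h₁, h₂, Preadditive.add_comp]
    | single σ r =>
      induction b using Finsupp.induction_linear with
      | zero =>
        refine (congrArg _ Limits.comp_zero).trans ?_
        simp
      | add b₁ b₂ h₁ h₂ =>
        refine (congrArg _
          (Preadditive.comp_add (C := CategoryTheory.Free ℂ C) _ _ _ _ b₁ b₂)).trans ?_
        rw [map_add, map_add, h₁, h₂, Preadditive.comp_add]
      | single τ s =>
        refine (congrArg _ (CategoryTheory.Free.single_comp_single ℂ C σ τ r s)).trans ?_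
        simp only [Finsupp.linearCombination_single, Linear.smul_comp, Linear.comp_smul, smul_smul]
        rw [mul_comm s r]
        exact congrArg ((r * s) • ·) (F.map_comp (X := (show C from X)) σ τ)

theorem linExtend_map_embedding {C : Type} [Category.{0} C] (F : C ⥤ ModuleCat.{0} ℂ) {X Y : C}
    (σ : X ⟶ Y) : (linExtend F).map ((CategoryTheory.Free.embedding ℂ C).map σ) = F.map σ := by
  have h : Finsupp.linearCombination ℂ (fun τ : X ⟶ Y => F.map τ) (Finsupp.single σ 1) =
      F.map σ := by
    rw [Finsupp.linearCombination_single, one_smul]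
  exact h

instance linExtend_additive {C : Type} [Category.{0} C] (F : C ⥤ ModuleCat.{0} ℂ) :
    (linExtend F).Additive where
  map_add {X Y a b} :=
    map_add (Finsupp.linearCombination ℂ
      (fun σ : (show C from X) ⟶ (show C from Y) => F.map σ)) a b

instance linExtend_linear {C : Type} [Category.{0} C] (F : C ⥤ ModuleCat.{0} ℂ) :
    (linExtend F).Linear ℂ where
  map_smul {X Y} a r :=
    map_smul (Finsupp.linearCombination ℂ
      (fun σ : (show C from X) ⟶ (show C from Y) => F.map σ)) r a

/-! ### The groupoid of colourings -/

/-- Objects of the groupoid `𝒢_(ℓ,d)`: maps from a `d`-element set to the set of `ℓ` colours. -/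
@[ext]
structure Coloring (ℓ d : ℕ) where
  color : Fin d → Fin ℓ

/-- Morphisms `f ⟶ g` are the bijections `σ` with `g ∘ σ = f`; composition is composition of
maps. -/
instance Coloring.category (ℓ d : ℕ) : Category.{0} (Coloring ℓ d) where
  Hom f g := {σ : Equiv.Perm (Fin d) // g.color ∘ σ = f.color}
  id f := ⟨Equiv.refl _, rfl⟩
  comp {f g h} σ τ := ⟨σ.1.trans τ.1, by
    funext x
    exact (congrFun τ.2 (σ.1 x)).trans (congrFun σ.2 x)⟩

/-- The bijection underlying a morphism. -/
def Coloring.perm {ℓ d : ℕ} {f g : Coloring ℓ d} (σ : f ⟶ g) : Equiv.Perm (Fin d) := σ.1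

theorem Coloring.color_perm {ℓ d : ℕ} {f g : Coloring ℓ d} (σ : f ⟶ g) (x : Fin d) :
    g.color (Coloring.perm σ x) = f.color x := congrFun σ.2 x

/-- The `ℂ`-linear category `ℂ𝒢_(ℓ,d)` generated by the groupoid `𝒢_(ℓ,d)`. -/
abbrev LinColoring (ℓ d : ℕ) : Type := CategoryTheory.Free ℂ (Coloring ℓ d)

/-- The set of points of colour `i`. -/
abbrev Coloring.Fiber {ℓ d : ℕ} (f : Coloring ℓ d) (i : Fin ℓ) : Type := {x : Fin d // f.color x = i}

/-- The type of `f`: the number of points of each colour. -/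
def Coloring.type {ℓ d : ℕ} (f : Coloring ℓ d) (i : Fin ℓ) : ℕ := Fintype.card (f.Fiber i)

/-- The bijection between the sets of points of colour `i` given by a morphism. -/
def Coloring.fiberEquiv {ℓ d : ℕ} {f g : Coloring ℓ d} (σ : f ⟶ g) (i : Fin ℓ) :
    f.Fiber i ≃ g.Fiber i :=
  (Coloring.perm σ).subtypeEquiv fun x => by rw [Coloring.color_perm]

theorem Coloring.type_eq {ℓ d : ℕ} {f g : Coloring ℓ d} (σ : f ⟶ g) : f.type = g.type :=
  funext fun i => Fintype.card_congr (Coloring.fiberEquiv σ i)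

/-- If `f` and `g` are both of type `lam`, a morphism `σ : f ⟶ g` gives an element of
`S_lam = S_{lam 1} × ⋯ × S_{lam ℓ}`: identify the points of colour `i` of `f`, respectively `g`,
with `{1, …, lam i}` in the order preserving way. -/
def Coloring.toYoung {ℓ d : ℕ} {lam : Fin ℓ → ℕ} {f g : Coloring ℓ d} (σ : f ⟶ g)
    (hf : f.type = lam) (hg : g.type = lam) (i : Fin ℓ) : Equiv.Perm (Fin (lam i)) :=
  ((Fintype.orderIsoFinOfCardEq (f.Fiber i) (congrFun hf i)).toEquiv.trans
    (Coloring.fiberEquiv σ i)).trans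
    (Fintype.orderIsoFinOfCardEq (g.Fiber i) (congrFun hg i)).toEquiv.symm

theorem Coloring.toYoung_id {ℓ d : ℕ} {lam : Fin ℓ → ℕ} (f : Coloring ℓ d) (hf : f.type = lam) :
    Coloring.toYoung (𝟙 f) hf hf = 1 := by
  funext i
  ext x
  change ((Fintype.orderIsoFinOfCardEq (f.Fiber i) (congrFun hf i)).symm
    (Fintype.orderIsoFinOfCardEq (f.Fiber i) (congrFun hf i) x) : ℕ) = x
  rw [OrderIso.symm_apply_apply]

theorem Coloring.toYoung_comp {ℓ d : ℕ} {lam : Fin ℓ → ℕ} {f g h : Coloring ℓ d} (σ : f ⟶ g)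
    (τ : g ⟶ h) (hf : f.type = lam) (hg : g.type = lam) (hh : h.type = lam) :
    Coloring.toYoung (σ ≫ τ) hf hh = Coloring.toYoung τ hg hh * Coloring.toYoung σ hf hg := by
  funext i
  ext x
  simp only [Pi.mul_apply, Equiv.Perm.mul_apply, Coloring.toYoung, Equiv.trans_apply,
    Equiv.apply_symm_apply]
  rfl

/-! ### Specht modules -/

/-- Tableaux of shape `μ` with entries `1, …, n`, `n = |μ|`; the tableau `t` has the entry `x` in
the cell `t x`. -/
abbrev Tableau (μ : YoungDiagram) : Type := Fin μ.card ≃ μ.cells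

/-- The tabloid `{t}` of a tableau `t`, recorded by the function which sends every entry to its row:
two tableaux are row equivalent if and only if these functions agree. -/
def Tableau.tabloid {μ : YoungDiagram} (t : Tableau μ) : Fin μ.card → ℕ := fun x => (t x).1.1

/-- The action of permutations on tableaux, replacing each entry `x` by `π x`. -/
def Tableau.act {μ : YoungDiagram} (π : Equiv.Perm (Fin μ.card)) (t : Tableau μ) : Tableau μ :=
  π.symm.trans t

/-- `π` lies in the column stabilizer of `t`. -/
def Tableau.IsColStab {μ : YoungDiagram} (t : Tableau μ) (π : Equiv.Perm (Fin μ.card)) : Prop :=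
  ∀ x, (t (π x)).1.2 = (t x).1.2

/-- The permutation representation of `S_n` on the complex functions on the set of all maps
`{1, …, n} → ℕ`; it sends the indicator function of `r` to that of `r ∘ π⁻¹`. The indicator
functions of the tabloids of shape `μ` span the permutation module `M^μ` inside it. -/
def rowRep (n : ℕ) : Representation ℂ (Equiv.Perm (Fin n)) ((Fin n → ℕ) → ℂ) where
  toFun π := LinearMap.funLeft ℂ ℂ fun r => r ∘ π
  map_one' := rfl
  map_mul' _ _ := rfl

open Classical in
/-- The polytabloid `e_t`, the sum of `sgn(π) {π t}` over the column stabilizer of `t`. -/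
def Tableau.polytabloid {μ : YoungDiagram} (t : Tableau μ) : (Fin μ.card → ℕ) → ℂ :=
  ∑ π : Equiv.Perm (Fin μ.card) with t.IsColStab π,
    Pi.single (Tableau.act π t).tabloid ((Equiv.Perm.sign π : ℤ) : ℂ)

theorem Tableau.rowRep_polytabloid {μ : YoungDiagram} (t : Tableau μ)
    (σ : Equiv.Perm (Fin μ.card)) :
    rowRep μ.card σ t.polytabloid = (Tableau.act σ t).polytabloid := by
  classical
  rw [Tableau.polytabloid, Tableau.polytabloid, map_sum]
  refine Finset.sum_equiv (MulAut.conj σ).toEquiv (fun π => ?_) (fun π _ => ?_)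
  · rw [Finset.mem_filter_univ, Finset.mem_filter_univ]
    constructor
    · intro h x
      have := h (σ.symm x)
      simpa [Tableau.act] using this
    · intro h x
      have := h (σ x)
      simpa [Tableau.act] using this
  · have h1 : rowRep μ.card σ (Pi.single (Tableau.act π t).tabloid
        ((Equiv.Perm.sign π : ℤ) : ℂ)) =
        Pi.single ((Tableau.act π t).tabloid ∘ σ.symm) ((Equiv.Perm.sign π : ℤ) : ℂ) :=
      by
        funext r
        change Pi.single (M := fun _ => ℂ) _ _ (r ∘ σ) = Pi.single (M := fun _ => ℂ) _ _ r
        have h3 : r ∘ σ = (Tableau.act π t).tabloid ↔ r = (Tableau.act π t).tabloid ∘ σ.symm :=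
          (Equiv.eq_comp_symm σ r _).symm
        simp only [Pi.single_apply, h3]
    rw [h1]
    congr 1
    · funext x
      change (t (π.symm (σ.symm x))).1.1 = (t (σ.symm (σ (π.symm (σ.symm x))))).1.1
      rw [Equiv.symm_apply_apply]
    · have h2 : Equiv.Perm.sign (σ * π * σ⁻¹) = Equiv.Perm.sign π := by
        rw [Equiv.Perm.sign_mul, Equiv.Perm.sign_mul, Equiv.Perm.sign_inv, mul_right_comm,
          Int.units_mul_self, one_mul]
      exact congrArg (fun u : ℤˣ => ((u : ℤ) : ℂ)) h2.symm

/-- The Specht module `𝒮_μ`, the span of all polytabloids of shape `μ`. -/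
def specht (μ : YoungDiagram) : Submodule ℂ ((Fin μ.card → ℕ) → ℂ) :=
  Submodule.span ℂ (Set.range fun t : Tableau μ => t.polytabloid)

theorem rowRep_mem_specht {μ : YoungDiagram} (σ : Equiv.Perm (Fin μ.card)) :
    ∀ v ∈ specht μ, rowRep μ.card σ v ∈ specht μ := by
  intro v hv
  have h : specht μ ≤ (specht μ).comap (rowRep μ.card σ) := by
    refine Submodule.span_le.2 ?_
    rintro _ ⟨t, rfl⟩
    exact Submodule.subset_span ⟨Tableau.act σ t, (t.rowRep_polytabloid σ).symm⟩
  exact h hv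

/-- The action of `S_n` on the Specht module `𝒮_μ`, `n = |μ|`. -/
def spechtRep (μ : YoungDiagram) : Representation ℂ (Equiv.Perm (Fin μ.card)) (specht μ) where
  toFun σ := (rowRep μ.card σ).restrict (rowRep_mem_specht σ)
  map_one' := by
    ext v : 2
    simp
  map_mul' σ τ := by
    ext v : 2
    simp

/-! ### The modules `L_p` -/

/-- The `ℓ`-multi-partitions of `d`: tuples `p = (p_1, …, p_ℓ)` of partitions (Young diagrams)
with `|p_1| + ⋯ + |p_ℓ| = d`. -/
structure MultiPartition (ℓ d : ℕ) where
  part : Fin ℓ → YoungDiagram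
  sum_card : ∑ i, (part i).card = d

/-- The shape `(|p_1|, …, |p_ℓ|)` of a multi-partition, a composition of `d` with `ℓ` parts. -/
abbrev MultiPartition.shape {ℓ d : ℕ} (p : MultiPartition ℓ d) (i : Fin ℓ) : ℕ := (p.part i).card

/-- The space `𝒮_p`, the tensor product of the Specht modules `𝒮_{p_i}`. -/
abbrev MultiSpecht {ℓ d : ℕ} (p : MultiPartition ℓ d) : Type := ⨂[ℂ] i, specht (p.part i)

/-- The action of the product of the symmetric groups `S_{|p_i|}` on `𝒮_p`. -/
def multiSpechtRep {ℓ d : ℕ} (p : MultiPartition ℓ d) :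
    Representation ℂ (∀ i, Equiv.Perm (Fin (p.shape i))) (MultiSpecht p) :=
  (PiTensorProduct.mapMonoidHom (R := ℂ) (s := fun i => specht (p.part i))).comp
    (MonoidHom.pi fun i => (spechtRep (p.part i)).comp (Pi.evalMonoidHom _ i))

theorem multiSpechtRep_tprod {ℓ d : ℕ} (p : MultiPartition ℓ d)
    (c : ∀ i, Equiv.Perm (Fin (p.shape i))) (v : ∀ i, specht (p.part i)) :
    multiSpechtRep p c (PiTensorProduct.tprod ℂ v) =
      PiTensorProduct.tprod ℂ fun i => spechtRep (p.part i) (c i) (v i) :=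
  PiTensorProduct.map_tprod _ _

/-- The functor on the groupoid underlying `L_p`. The space `L_p(f)` is `𝒮_p` if `f` has the same
type as `p` and zero otherwise, written as the space of functions from the set of proofs of this
equality to `𝒮_p`. A morphism acts through its image in the product of the symmetric groups
`S_{|p_i|}`. -/
def groupoidModule {ℓ d : ℕ} (p : MultiPartition ℓ d) : Coloring ℓ d ⥤ ModuleCat.{0} ℂ where
  obj f := ModuleCat.of ℂ (PLift (f.type = p.shape) → MultiSpecht p)
  map {f g} σ := ModuleCat.ofHom
    (LinearMap.pi fun hg : PLift (g.type = p.shape) =>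
      (multiSpechtRep p (Coloring.toYoung σ ((Coloring.type_eq σ).trans hg.down) hg.down)).comp
        (LinearMap.proj (PLift.up ((Coloring.type_eq σ).trans hg.down))))
  map_id f := by
    apply ModuleCat.hom_ext
    refine LinearMap.ext fun v => funext fun hf => ?_
    change multiSpechtRep p (Coloring.toYoung (𝟙 f) hf.down hf.down) (v hf) = v hf
    rw [Coloring.toYoung_id, map_one]
    rfl
  map_comp {f g h} σ τ := by
    apply ModuleCat.hom_ext
    refine LinearMap.ext fun v => funext fun hh => ?_
    have hg := (Coloring.type_eq τ).trans hh.down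
    have hf := (Coloring.type_eq σ).trans hg
    change multiSpechtRep p (Coloring.toYoung (σ ≫ τ) hf hh.down) (v ⟨hf⟩) =
      multiSpechtRep p (Coloring.toYoung τ hg hh.down)
        (multiSpechtRep p (Coloring.toYoung σ hf hg) (v ⟨hf⟩))
    rw [Coloring.toYoung_comp σ τ hf hg hh.down, map_mul]
    rfl

/-- The `ℂ𝒢_(ℓ,d)`-module `L_p`. -/
def simpleModule {ℓ d : ℕ} (p : MultiPartition ℓ d) : LinColoring ℓ d ⥤ ModuleCat.{0} ℂ :=
  linExtend (groupoidModule p)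

/-! ### The module `V^{⊗ d}` -/

/-- The subspace `V_i` of `V = ℂ^n`, `n = k_1 + ⋯ + k_ℓ`, spanned by the standard basis vectors
`v_j` in the `i`-th block, i.e. (with indices starting from `0`)
`k_1 + ⋯ + k_{i-1} ≤ j < k_1 + ⋯ + k_i`. -/
def blockSpace {ℓ : ℕ} (k : Fin ℓ → ℕ) (i : Fin ℓ) : Submodule ℂ (Fin (∑ m, k m) → ℂ) :=
  Submodule.span ℂ {v | ∃ j : Fin (∑ m, k m),
    ∑ m ∈ Finset.Iio i, k m ≤ (j : ℕ) ∧ (j : ℕ) < ∑ m ∈ Finset.Iic i, k m ∧ v = Pi.single j 1}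

/-- The space `G(f) = V_{f(1)} ⊗ ⋯ ⊗ V_{f(d)}`. -/
abbrev TensorSpace {ℓ d : ℕ} (k : Fin ℓ → ℕ) (f : Coloring ℓ d) : Type :=
  ⨂[ℂ] x : Fin d, blockSpace k (f.color x)

theorem blockSpace_le {ℓ d : ℕ} (k : Fin ℓ → ℕ) {f g : Coloring ℓ d} (σ : f ⟶ g) (x : Fin d) :
    blockSpace k (f.color ((Coloring.perm σ).symm x)) ≤ blockSpace k (g.color x) := by
  rw [← Coloring.color_perm σ, Equiv.apply_symm_apply]

/-- The map `G(σ) : G(f) → G(g)` permuting the tensor factors. -/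
def tensorMap {ℓ d : ℕ} (k : Fin ℓ → ℕ) {f g : Coloring ℓ d} (σ : f ⟶ g) :
    TensorSpace k f →ₗ[ℂ] TensorSpace k g :=
  (PiTensorProduct.map fun x => Submodule.inclusion (blockSpace_le k σ x)).comp
    (PiTensorProduct.reindex ℂ (fun x => blockSpace k (f.color x))
      (Coloring.perm σ)).toLinearMap

/-- `σ (w_1 ⊗ ⋯ ⊗ w_d) = w_{σ⁻¹(1)} ⊗ ⋯ ⊗ w_{σ⁻¹(d)}`. -/
theorem tensorMap_tprod {ℓ d : ℕ} (k : Fin ℓ → ℕ) {f g : Coloring ℓ d} (σ : f ⟶ g)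
    (w : ∀ x, blockSpace k (f.color x)) :
    tensorMap k σ (PiTensorProduct.tprod ℂ w) = PiTensorProduct.tprod ℂ fun x =>
      ⟨(w ((Coloring.perm σ).symm x)).1, blockSpace_le k σ x (w _).2⟩ := by
  rw [tensorMap, LinearMap.comp_apply, LinearEquiv.coe_coe, PiTensorProduct.reindex_tprod,
    PiTensorProduct.map_tprod]
  rfl

/-- The functor `f ↦ V_{f(1)} ⊗ ⋯ ⊗ V_{f(d)}` on the groupoid. -/
def groupoidTensor {ℓ : ℕ} (k : Fin ℓ → ℕ) (d : ℕ) : Coloring ℓ d ⥤ ModuleCat.{0} ℂ where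
  obj f := ModuleCat.of ℂ (TensorSpace k f)
  map σ := ModuleCat.ofHom (tensorMap k σ)
  map_id f := by
    apply ModuleCat.hom_ext
    apply PiTensorProduct.ext
    ext w
    exact tensorMap_tprod k (𝟙 f) w
  map_comp {f g h} σ τ := by
    apply ModuleCat.hom_ext
    apply PiTensorProduct.ext
    ext w
    change tensorMap k (σ ≫ τ) (PiTensorProduct.tprod ℂ w) =
      tensorMap k τ (tensorMap k σ (PiTensorProduct.tprod ℂ w))
    rw [tensorMap_tprod, tensorMap_tprod, tensorMap_tprod]
    rfl

/-- The `ℂ𝒢_(ℓ,d)`-module `V^{⊗ d} = ⨁_f V_{f(1)} ⊗ ⋯ ⊗ V_{f(d)}`. -/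
def tensorModule {ℓ : ℕ} (k : Fin ℓ → ℕ) (d : ℕ) : LinColoring ℓ d ⥤ ModuleCat.{0} ℂ :=
  linExtend (groupoidTensor k d)

instance tensorModule_additive {ℓ : ℕ} (k : Fin ℓ → ℕ) (d : ℕ) : (tensorModule k d).Additive :=
  linExtend_additive _

instance tensorModule_linear {ℓ : ℕ} (k : Fin ℓ → ℕ) (d : ℕ) : (tensorModule k d).Linear ℂ :=
  linExtend_linear _

end

noncomputable section

/-! ### Rearrangement of columns of Young diagrams -/

/-! Both inclusions work with explicit vectors; neither the simplicity of the modules L_p nor a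
semisimple decomposition of ℂ𝒢 is needed.

The kernel lies in the ideal. Matrix coefficients g ↦ v(r ∘ g) of Specht modules span a space
containing the delta function at 1 of S_n (`delta_mem_span_spechtCoefficients`). Indeed, a
functional killing all of them kills all Specht characters, and these span the class functions: one
diagram per cycle type gives the right number of characters, and averaging over Young subgroups
shows independence by triangularity. Multiplying over colours writes the delta function at 𝟙 X as a
sum of coefficients ξ_j(π v_j) of modules L_{p_j} (`exists_sum_colorEval`). Then every a : X → Y is
the sum of the images of the vectors a v_j under the homomorphisms L_{p_j} → ℂ𝒢(X, -) defined by ξ_j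
(`eq_sum_coeffMap`). If a kills V^{⊗d} and every component of p_j has at most k_i rows, the j-th
summand vanishes: its coefficients are either combinations of tensor coordinates or evaluations of
Specht vectors outside their support.

The ideal lies in the kernel. A homomorphism φ : L_p → ℂ𝒢(X, -) and a tensor u give the equivariant
map v ↦ φ(v) u from 𝒮_p to G(Y). If p_i has more than k_i rows, the first column of any tableau of
shape p_i contains two entries carrying the same basis index. Their transposition negates the
polytabloid and fixes the tensor coordinate, which is therefore zero (`equivariant_eq_zero`). -/

theorem sum_range_card_le_sum (A : Finset ℕ) :
    ∑ i ∈ Finset.range A.card, i ≤ ∑ i ∈ A, i ∧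
      (∑ i ∈ A, i = ∑ i ∈ Finset.range A.card, i → A = Finset.range A.card) := by
  set c := A.card with hc
  set R := Finset.range c with hR
  have hcard : (A \ R).card = (R \ A).card := by
    apply Finset.card_sdiff_comm
    rw [hR, Finset.card_range]
  have h1 : (A \ R).card * c ≤ ∑ i ∈ A \ R, i := by
    refine Finset.card_nsmul_le_sum _ _ _ fun i hi => ?_
    simp only [hR, Finset.mem_sdiff, Finset.mem_range, not_lt] at hi
    exact hi.2
  -- The summand `i + 1` leaves a surplus of `(R \ A).card` in the inequality, so equality of the
  -- two sums forces `R \ A` to be empty.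
  have h2 : ∑ i ∈ R \ A, (i + 1) ≤ (R \ A).card * c := by
    refine Finset.sum_le_card_nsmul _ _ _ fun i hi => ?_
    simp only [hR, Finset.mem_sdiff, Finset.mem_range] at hi
    exact hi.1
  rw [Finset.sum_add_distrib, Finset.sum_const, smul_eq_mul, mul_one] at h2
  have h3 := Finset.sum_inter_add_sum_sdiff A R (fun i => i)
  have h4 := Finset.sum_inter_add_sum_sdiff R A (fun i => i)
  rw [Finset.inter_comm] at h4
  rw [hcard] at h1
  refine ⟨by omega, fun h => ?_⟩
  have h5 : (R \ A).card = 0 := by omega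
  have h6 : (A \ R).card = 0 := by omega
  rw [Finset.card_eq_zero, Finset.sdiff_eq_empty_iff_subset] at h5 h6
  exact h6.antisymm h5

/-- In a column of length c the rows are 0, …, c - 1, the smallest possible sum of c distinct
naturals. Equality of the totals forces equality in every column, so `q` and the row function then
take the same values with the same multiplicities. -/
theorem sum_row_le_sum_of_injOn_columns {lam : YoungDiagram} {α : Type*} [Fintype α]
    (t : α ≃ lam.cells) (q : α → ℕ)
    (hq : ∀ x y, (t x).1.2 = (t y).1.2 → q x = q y → x = y) :
    ∑ x, (t x).1.1 ≤ ∑ x, q x ∧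
      (∑ x, q x = ∑ x, (t x).1.1 → ∀ f : ℕ → ℕ, ∑ x, f (q x) = ∑ x, f (t x).1.1) := by
  classical
  let S : ℕ → Finset α := fun j => Finset.univ.filter fun x => (t x).1.2 = j
  have hS : ∀ g : α → ℕ, ∑ x, g x =
      ∑ j ∈ Finset.univ.image (fun x => (t x).1.2), ∑ x ∈ S j, g x := fun g =>
    (Finset.sum_fiberwise_of_maps_to (fun x _ => Finset.mem_image_of_mem _ (Finset.mem_univ x)) g).symm
  have hinj : ∀ j, Set.InjOn q (S j) := by
    intro j x hx y hy h
    simp only [S, Finset.coe_filter, Finset.mem_univ, true_and, Set.mem_ofPred_eq] at hx hy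
    exact hq x y (hx.trans hy.symm) h
  have tinj : ∀ j, Set.InjOn (fun x => (t x).1.1) (S j) := by
    intro j x hx y hy h
    simp only [S, Finset.coe_filter, Finset.mem_univ, true_and, Set.mem_ofPred_eq] at hx hy
    exact t.injective (Subtype.ext (Prod.ext h (hx.trans hy.symm)))
  have timg : ∀ j, (S j).image (fun x => (t x).1.1) = Finset.range (S j).card := by
    intro j
    have h : (S j).image (fun x => (t x).1.1) = Finset.range (lam.colLen j) := by
      ext i
      simp only [S, Finset.mem_image, Finset.mem_filter, Finset.mem_univ, true_and,
        Finset.mem_range, ← YoungDiagram.mem_iff_lt_colLen]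
      constructor
      · rintro ⟨x, rfl, rfl⟩
        exact (YoungDiagram.mem_cells _).1 (t x).2
      · intro h
        refine ⟨t.symm ⟨(i, j), (YoungDiagram.mem_cells _).2 h⟩, ?_⟩
        simp
    have h' := congrArg Finset.card h
    rw [Finset.card_image_of_injOn (tinj j), Finset.card_range] at h'
    rw [h, h']
  have hle : ∀ j, ∑ x ∈ S j, (t x).1.1 ≤ ∑ x ∈ S j, q x ∧
      (∑ x ∈ S j, q x = ∑ x ∈ S j, (t x).1.1 →
        ∀ f : ℕ → ℕ, ∑ x ∈ S j, f (q x) = ∑ x ∈ S j, f (t x).1.1) := by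
    intro j
    have key := sum_range_card_le_sum ((S j).image q)
    rw [Finset.card_image_of_injOn (hinj j), ← timg j, Finset.sum_image (tinj j),
      Finset.sum_image (hinj j)] at key
    refine ⟨key.1, fun h f => ?_⟩
    rw [← Finset.sum_image (f := f) (hinj j), key.2 h, Finset.sum_image (tinj j)]
  refine ⟨?_, fun h f => ?_⟩
  · rw [hS, hS]
    exact Finset.sum_le_sum fun j _ => (hle j).1
  · rw [hS, hS fun x => (t x).1.1] at h
    have := (Finset.sum_eq_sum_iff_of_le fun j _ => (hle j).1).1 h.symm
    rw [hS fun x => f (q x), hS]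
    exact Finset.sum_congr rfl fun j hj => (hle j).2 (this j hj).symm f

theorem card_row_fiber {mu : YoungDiagram} {α : Type*} [Fintype α] (s : α ≃ mu.cells) (i : ℕ) :
    ∑ x, (if (s x).1.1 = i then 1 else 0) = mu.rowLen i := by
  classical
  rw [YoungDiagram.rowLen_eq_card, YoungDiagram.row,
    Fintype.sum_equiv s (fun x => if (s x).1.1 = i then 1 else 0)
      (fun c => if c.1.1 = i then 1 else 0) fun x => rfl,
    Finset.sum_coe_sort mu.cells fun c => if c.1 = i then 1 else 0, Finset.sum_boole]
  simp

theorem YoungDiagram.eq_of_rowLen_eq {lam mu : YoungDiagram} (h : ∀ i, lam.rowLen i = mu.rowLen i) :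
    lam = mu := by
  ext ⟨i, j⟩
  rw [YoungDiagram.mem_cells, YoungDiagram.mem_cells, YoungDiagram.mem_iff_lt_rowLen,
    YoungDiagram.mem_iff_lt_rowLen, h]

/-- The sum of the row indices of all cells, the statistic `∑ i * μ_i`. -/
def YoungDiagram.rowStat (mu : YoungDiagram) : ℕ := ∑ c ∈ mu.cells, c.1

theorem YoungDiagram.sum_row_eq_rowStat {mu : YoungDiagram} {α : Type*} [Fintype α]
    (s : α ≃ mu.cells) : ∑ x, (s x).1.1 = mu.rowStat := by
  rw [YoungDiagram.rowStat, ← Finset.sum_coe_sort mu.cells fun c => c.1]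
  exact Fintype.sum_equiv s _ _ fun x => rfl

/-- This numerical statistic takes the place of the dominance order. In the case of equality,
counting the entries in row `i` shows that the diagrams have the same row lengths. -/
theorem YoungDiagram.eq_or_rowStat_lt {lam mu : YoungDiagram} {α : Type*} [Fintype α]
    (t : α ≃ lam.cells) (s : α ≃ mu.cells)
    (h : ∀ x y, (t x).1.2 = (t y).1.2 → (s x).1.1 = (s y).1.1 → x = y) :
    lam = mu ∨ lam.rowStat < mu.rowStat := by
  have key := sum_row_le_sum_of_injOn_columns t (fun x => (s x).1.1) h
  rw [sum_row_eq_rowStat, sum_row_eq_rowStat] at key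
  rcases key.1.eq_or_lt with h1 | h1
  · left
    refine YoungDiagram.eq_of_rowLen_eq fun i => ?_
    rw [← card_row_fiber t, ← card_row_fiber s]
    exact (key.2 h1.symm fun j => if j = i then 1 else 0).symm
  · exact Or.inr h1

/-! ### Polytabloids -/

theorem Tableau.polytabloid_apply {mu : YoungDiagram} (t : Tableau mu) (r : Fin mu.card → ℕ)
    [DecidablePred t.IsColStab] :
    t.polytabloid r = ∑ π : Equiv.Perm (Fin mu.card) with t.IsColStab π,
      if r ∘ π = t.tabloid then ((Equiv.Perm.sign π : ℤ) : ℂ) else 0 := by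
  classical
  rw [Tableau.polytabloid, Finset.sum_apply]
  refine Finset.sum_congr (by congr) fun π _ => ?_
  rw [Pi.single_apply]
  refine if_congr ?_ rfl rfl
  exact Equiv.eq_comp_symm π r t.tabloid

theorem Tableau.polytabloid_eq_zero {mu : YoungDiagram} (t : Tableau mu) (r : Fin mu.card → ℕ)
    (h : ∀ π : Equiv.Perm (Fin mu.card), r ∘ π ≠ t.tabloid) : t.polytabloid r = 0 := by
  classical
  rw [Tableau.polytabloid_apply]
  exact Finset.sum_eq_zero fun π _ => if_neg (h π)

/-- Only the identity preserves both the row and the column of every entry, so a single term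
survives. -/
theorem Tableau.polytabloid_tabloid {mu : YoungDiagram} (t : Tableau mu) :
    t.polytabloid t.tabloid = 1 := by
  classical
  rw [Tableau.polytabloid_apply, Finset.sum_eq_single 1]
  · simp
  · intro π hπ hne
    refine if_neg fun h => hne ?_
    ext x
    rw [Finset.mem_filter] at hπ
    have : t (π x) = t x := Subtype.ext (Prod.ext (congrFun h x) (hπ.2 x))
    rw [t.injective this, Equiv.Perm.one_apply]
  · intro h
    exact absurd (Finset.mem_filter.2 ⟨Finset.mem_univ _, fun x => rfl⟩) h

theorem Tableau.rowRep_swap_polytabloid {mu : YoungDiagram} (t : Tableau mu) {x y : Fin mu.card}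
    (hxy : x ≠ y) (hcol : (t x).1.2 = (t y).1.2) :
    rowRep mu.card (Equiv.swap x y) t.polytabloid = -t.polytabloid := by
  classical
  have hswap : ∀ z, (t (Equiv.swap x y z)).1.2 = (t z).1.2 := by
    intro z
    rw [Equiv.swap_apply_def]
    split_ifs with h1 h2
    · rw [h1, hcol]
    · rw [h2, hcol]
    · rfl
  funext r
  change t.polytabloid (r ∘ Equiv.swap x y) = -t.polytabloid r
  rw [Tableau.polytabloid_apply, Tableau.polytabloid_apply, ← Finset.sum_neg_distrib]
  refine Finset.sum_equiv (Equiv.mulLeft (Equiv.swap x y)) (fun π => ?_) fun π _ => ?_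
  · rw [Finset.mem_filter_univ, Finset.mem_filter_univ]
    simp only [Tableau.IsColStab, Equiv.coe_mulLeft, Equiv.Perm.mul_apply, hswap]
  · simp only [Equiv.coe_mulLeft, Equiv.Perm.coe_mul, Function.comp_assoc, Equiv.Perm.sign_mul,
      Equiv.Perm.sign_swap hxy]
    split_ifs <;> simp

/-! ### Invariants of Young subgroups in Specht modules -/

/-- The permutations preserving the function `q`. -/
def fiberStabilizer {α β : Type*} (q : α → β) : Subgroup (Equiv.Perm α) where
  carrier := {g | q ∘ g = q}
  mul_mem' {a b} ha hb := by
    change q ∘ (a * b) = q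
    rw [Equiv.Perm.coe_mul, ← Function.comp_assoc, ha, hb]
  one_mem' := rfl
  inv_mem' {a} ha := by
    change q ∘ (a⁻¹ : Equiv.Perm α) = q
    funext x
    have := congrFun (show q ∘ a = q from ha) ((a⁻¹ : Equiv.Perm α) x)
    simpa using this.symm

theorem mem_fiberStabilizer {α β : Type*} (q : α → β) (g : Equiv.Perm α) :
    g ∈ fiberStabilizer q ↔ q ∘ g = q := Iff.rfl

instance specht_finite (mu : YoungDiagram) : Module.Finite ℂ (specht mu) :=
  Module.Finite.span_of_finite ℂ (Set.finite_range _)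

open Classical in
-- If every tableau had two entries in one column with the same `q`-value, their transposition would
-- lie in the stabilizer of `q` and negate the polytabloid. The sum `A` over the stabilizer would
-- then kill the whole Specht module, whereas it multiplies the invariant `v` by the order of the
-- stabilizer.
theorem exists_injOn_columns_of_invariant {lam : YoungDiagram} (q : Fin lam.card → ℕ)
    {v : (Fin lam.card → ℕ) → ℂ} (hv : v ∈ specht lam) (hv0 : v ≠ 0)
    (hinv : ∀ g ∈ fiberStabilizer q, rowRep lam.card g v = v) :
    ∃ t : Tableau lam, ∀ x y, (t x).1.2 = (t y).1.2 → q x = q y → x = y := by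
  by_contra! hcon
  let A := ∑ g : fiberStabilizer q, rowRep lam.card g.1
  have hA : ∀ w ∈ specht lam, A w = 0 := by
    suffices specht lam ≤ LinearMap.ker A from fun w hw => this hw
    refine Submodule.span_le.2 ?_
    rintro _ ⟨t, rfl⟩
    obtain ⟨x, y, hcol, hqxy, hxy⟩ := hcon t
    have hmem : Equiv.swap x y ∈ fiberStabilizer q := by
      rw [mem_fiberStabilizer]
      funext z
      simp only [Function.comp_apply, Equiv.swap_apply_def]
      split_ifs with h1 h2
      · rw [h1, hqxy]
      · rw [h2, hqxy]
      · rfl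
    -- Right translation by the transposition permutes the terms of `A`.
    have h1 : A (rowRep lam.card (Equiv.swap x y) t.polytabloid) = A t.polytabloid := by
      simp only [A, LinearMap.sum_apply]
      refine Fintype.sum_equiv (Equiv.mulRight ⟨_, hmem⟩) _ _ fun g => ?_
      simp only [Equiv.coe_mulRight, Subgroup.coe_mul, map_mul, Module.End.mul_apply]
    rw [t.rowRep_swap_polytabloid hxy hcol, map_neg] at h1
    exact self_eq_neg.1 h1.symm
  have h2 : A v = (Fintype.card (fiberStabilizer q) : ℂ) • v := by
    simp only [A, LinearMap.sum_apply]
    rw [Finset.sum_congr rfl fun g _ => hinv g.1 g.2, Finset.sum_const, Finset.card_univ,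
      Nat.cast_smul_eq_nsmul]
  rw [hA v hv] at h2
  rcases smul_eq_zero.1 h2.symm with h | h
  · exact Fintype.card_ne_zero (Nat.cast_eq_zero.1 h)
  · exact hv0 h

open Classical in
-- The polytabloid is symmetrized over the row stabilizer. Every term takes the value 1 at the
-- tabloid of `t`, so the sum is nonzero there.
theorem exists_invariant_tabloid {lam : YoungDiagram} (t : Tableau lam) :
    ∃ v ∈ specht lam, v ≠ 0 ∧ ∀ g ∈ fiberStabilizer t.tabloid, rowRep lam.card g v = v := by
  refine ⟨∑ g : fiberStabilizer t.tabloid, rowRep lam.card g.1 t.polytabloid, ?_, ?_, ?_⟩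
  · exact Submodule.sum_mem _ fun g _ =>
      rowRep_mem_specht g.1 _ (Submodule.subset_span ⟨t, rfl⟩)
  · intro h
    have h1 := congrFun h t.tabloid
    rw [Finset.sum_apply, Finset.sum_congr rfl fun g _ => (show rowRep lam.card g.1 t.polytabloid
      t.tabloid = 1 from (congrArg t.polytabloid g.2).trans t.polytabloid_tabloid)] at h1
    rw [Finset.sum_const, Finset.card_univ, nsmul_one] at h1
    exact Fintype.card_ne_zero (Nat.cast_eq_zero.1 h1)
  · intro g hg
    rw [map_sum]
    refine Fintype.sum_equiv (Equiv.mulLeft ⟨g, hg⟩) _ _ fun g' => ?_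
    simp only [Equiv.coe_mulLeft, Subgroup.coe_mul, map_mul, Module.End.mul_apply]

/-- The Specht module of a diagram with `n` cells, as a representation of `S_n`. -/
def spechtRepOfCard {n : ℕ} (mu : YoungDiagram) (h : mu.card = n) :
    Representation ℂ (Equiv.Perm (Fin n)) (specht mu) :=
  (spechtRep mu).comp (finCongr h.symm).permCongrHom.toMonoidHom

theorem spechtRepOfCard_apply {n : ℕ} {mu : YoungDiagram} (h : mu.card = n)
    (g : Equiv.Perm (Fin n)) (v : specht mu) (r : Fin n → ℕ) :
    (spechtRepOfCard mu h g v).1 (r ∘ Fin.cast h) = v.1 (r ∘ g ∘ Fin.cast h) := by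
  subst h
  rfl

open Classical in
-- Divided by the group order, the character sum is the dimension of the space of invariants.
theorem sum_character_fiberStabilizer {n : ℕ} {lam : YoungDiagram} (h : lam.card = n)
    (q : Fin n → ℕ) :
    (∑ g : fiberStabilizer q, (spechtRepOfCard lam h).character g.1 ≠ 0) ↔
      ∃ v ∈ specht lam, v ≠ 0 ∧
        ∀ g ∈ fiberStabilizer (q ∘ Fin.cast h), rowRep lam.card g v = v := by
  subst h
  let ρ : Representation ℂ (fiberStabilizer q) (specht lam) :=
    (spechtRepOfCard lam rfl).comp (fiberStabilizer q).subtype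
  have hne : (Nat.card (fiberStabilizer q) : ℂ) ≠ 0 := Nat.cast_ne_zero.2 Nat.card_pos.ne'
  let _ : Invertible (Nat.card (fiberStabilizer q) : ℂ) := invertibleOfNonzero hne
  have key := ρ.card_inv_mul_sum_char_eq_finrank
  have h0 : (∑ g : fiberStabilizer q, (spechtRepOfCard lam rfl).character g.1 ≠ 0) ↔
      Module.finrank ℂ ρ.invariants ≠ 0 := by
    rw [← Nat.cast_ne_zero (R := ℂ), ← key]
    exact ((mul_ne_zero_iff_left (inv_ne_zero hne))).symm
  rw [h0, ← Nat.pos_iff_ne_zero]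
  refine (Module.finrank_pos_iff_exists_ne_zero (R := ℂ) (M := ρ.invariants)).trans ?_
  constructor
  · rintro ⟨⟨⟨v, hv⟩, hinv⟩, hv0⟩
    refine ⟨v, hv, fun h => hv0 ?_, fun g hg => ?_⟩
    · subst h
      rfl
    · exact congrArg Subtype.val (hinv ⟨g, hg⟩)
  · rintro ⟨v, hv, hv0, hinv⟩
    refine ⟨⟨⟨v, hv⟩, fun g => Subtype.ext (hinv g.1 g.2)⟩, fun h => hv0 ?_⟩
    exact congrArg (fun w => w.1.1) h

open Classical in
theorem eq_or_rowStat_lt_of_sum_character_ne_zero {n : ℕ} {lam mu : YoungDiagram}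
    (h : lam.card = n) (s : Fin n ≃ mu.cells)
    (hne : ∑ g : fiberStabilizer fun x => (s x).1.1, (spechtRepOfCard lam h).character g.1 ≠ 0) :
    lam = mu ∨ lam.rowStat < mu.rowStat := by
  obtain ⟨v, hv, hv0, hinv⟩ := (sum_character_fiberStabilizer h _).1 hne
  obtain ⟨t, ht⟩ := exists_injOn_columns_of_invariant _ hv hv0 hinv
  exact YoungDiagram.eq_or_rowStat_lt t ((finCongr h).trans s) ht

open Classical in
theorem sum_character_self_ne_zero {n : ℕ} {lam : YoungDiagram}
    (h : lam.card = n) (s : Fin n ≃ lam.cells) :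
    ∑ g : fiberStabilizer fun x => (s x).1.1, (spechtRepOfCard lam h).character g.1 ≠ 0 :=
  (sum_character_fiberStabilizer h _).2 (exists_invariant_tabloid ((finCongr h).trans s))

/-! ### Faithfulness of the sum of all Specht modules -/

theorem YoungDiagram.card_ofRowLens (w : List ℕ) (hw : w.SortedGE) :
    (YoungDiagram.ofRowLens w hw).card = w.sum := by
  change (YoungDiagram.cellsOfRowLens w).card = w.sum
  clear hw
  induction w with
  | nil => rfl
  | cons a w ih =>
    rw [YoungDiagram.cellsOfRowLens, Finset.card_union_of_disjoint, Finset.card_map, ih,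
      Finset.card_product, Finset.card_singleton, Finset.card_range, one_mul, List.sum_cons]
    rw [Finset.disjoint_left]
    rintro ⟨i, j⟩ h1 h2
    simp only [Finset.mem_product, Finset.mem_singleton, Finset.mem_map] at h1 h2
    obtain ⟨⟨c1, c2⟩, -, h⟩ := h2
    have h3 : c1 + 1 = i := congrArg Prod.fst h
    omega

/-- The Young diagram whose row lengths are the cycle lengths of a permutation. -/
def cycleDiagram {n : ℕ} (g : Equiv.Perm (Fin n)) : YoungDiagram :=
  YoungDiagram.ofRowLens (g.partition.parts.sort (· ≥ ·))
    (Multiset.pairwise_sort _ _).sortedGE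

theorem cycleDiagram_card {n : ℕ} (g : Equiv.Perm (Fin n)) : (cycleDiagram g).card = n := by
  rw [cycleDiagram, YoungDiagram.card_ofRowLens, ← Multiset.sum_coe, Multiset.sort_eq,
    g.partition.parts_sum, Fintype.card_fin]

theorem cycleDiagram_eq_iff {n : ℕ} (g g' : Equiv.Perm (Fin n)) :
    cycleDiagram g = cycleDiagram g' ↔ IsConj g g' := by
  rw [Equiv.Perm.partition_eq_of_isConj]
  constructor
  · intro h
    have h1 := congrArg YoungDiagram.rowLens h
    -- The list of row lengths is recovered because cycle lengths, fixed points included, are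
    -- positive.
    rw [cycleDiagram, cycleDiagram, YoungDiagram.rowLens_ofRowLens_eq_self,
      YoungDiagram.rowLens_ofRowLens_eq_self] at h1
    · have h2 := congrArg (fun l : List ℕ => (l : Multiset ℕ)) h1
      simp only [Multiset.sort_eq] at h2
      exact Nat.Partition.ext h2
    · exact fun x hx => g'.partition.parts_pos ((Multiset.mem_sort _).1 hx)
    · exact fun x hx => g.partition.parts_pos ((Multiset.mem_sort _).1 hx)
  · intro h
    rw [cycleDiagram, cycleDiagram]
    congr 2
    rw [h]

/-- The character of a Specht module, as a function on conjugacy classes. -/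
def spechtClassCharacter {n : ℕ} (mu : YoungDiagram) (h : mu.card = n) :
    ConjClasses (Equiv.Perm (Fin n)) → ℂ :=
  Quotient.lift (spechtRepOfCard mu h).character (by
    intro a b hab
    obtain ⟨c, rfl⟩ := isConj_iff.1 hab
    exact ((spechtRepOfCard mu h).char_conj a c).symm)

open Classical in
-- A relation is averaged over the row stabilizer of a diagram with minimal `rowStat` among those
-- with nonzero coefficient. Any other diagram contributing to the average would have smaller
-- `rowStat`, so only the chosen one remains, and its average is nonzero.
theorem linearIndependent_spechtClassCharacter {n : ℕ} {ι : Type*} [Finite ι]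
    (D : ι → YoungDiagram) (hD : Function.Injective D) (hcard : ∀ i, (D i).card = n) :
    LinearIndependent ℂ fun i => spechtClassCharacter (D i) (hcard i) := by
  have := Fintype.ofFinite ι
  rw [Fintype.linearIndependent_iff]
  intro c hc
  by_contra! hcon
  obtain ⟨i₀, hi₀, hmin⟩ := (Finset.univ.filter fun i => c i ≠ 0).exists_min_image
    (fun i => (D i).rowStat) (by
      obtain ⟨i, hi⟩ := hcon
      exact ⟨i, by simpa using hi⟩)
  rw [Finset.mem_filter_univ] at hi₀
  let s : Fin n ≃ (D i₀).cells :=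
    Fintype.equivOfCardEq (by rw [Fintype.card_fin, Fintype.card_coe]; exact (hcard i₀).symm)
  have h1 : ∑ i, c i * ∑ g : fiberStabilizer fun x => (s x).1.1,
      (spechtRepOfCard (D i) (hcard i)).character g.1 = 0 := by
    simp_rw [Finset.mul_sum]
    rw [Finset.sum_comm]
    refine Finset.sum_eq_zero fun g _ => ?_
    have := congrFun hc (ConjClasses.mk g.1)
    rw [Finset.sum_apply] at this
    exact this
  rw [Finset.sum_eq_single i₀] at h1
  · rcases mul_eq_zero.1 h1 with h | h
    · exact hi₀ h
    · exact sum_character_self_ne_zero (hcard i₀) s h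
  · intro i _ hi
    by_contra hne
    have h2 := mul_ne_zero_iff.1 hne
    rcases eq_or_rowStat_lt_of_sum_character_ne_zero (hcard i) s h2.2 with h | h
    · exact hi (hD h)
    · exact absurd (hmin i (by simpa using h2.1)) (not_le.2 h)
  · exact fun h => absurd (Finset.mem_univ _) h

theorem span_spechtClassCharacter (n : ℕ) :
    Submodule.span ℂ (Set.range fun c : ConjClasses (Equiv.Perm (Fin n)) =>
      spechtClassCharacter (cycleDiagram c.out) (cycleDiagram_card c.out)) = ⊤ := by
  classical
  have : Nonempty (ConjClasses (Equiv.Perm (Fin n))) := ⟨ConjClasses.mk 1⟩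
  have := Fintype.ofFinite (ConjClasses (Equiv.Perm (Fin n)))
  refine LinearIndependent.span_eq_top_of_card_eq_finrank
    (linearIndependent_spechtClassCharacter (fun c : ConjClasses (Equiv.Perm (Fin n)) =>
      cycleDiagram c.out) (fun c c' h => ?_) _) (by simp)
  have h1 := ConjClasses.mk_eq_mk_iff_isConj.2 ((cycleDiagram_eq_iff _ _).1 h)
  rwa [← Quotient.out_eq c, ← Quotient.out_eq c']

/-- The matrix coefficients of the Specht modules with `n` boxes. -/
def spechtCoefficients (n : ℕ) : Set (Equiv.Perm (Fin n) → ℂ) :=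
  {F | ∃ (mu : YoungDiagram) (h : mu.card = n) (v : specht mu) (r : Fin n → ℕ),
    F = fun g : Equiv.Perm (Fin n) => v.1 (r ∘ g ∘ Fin.cast h)}

/-- A separating functional `f` is an element ∑ f(δ_g) g of the group algebra that acts by zero on
every Specht module. Taking traces, `f` kills the Specht characters, hence all class functions; but
the delta function at 1 is a class function. -/
theorem delta_mem_span_spechtCoefficients (n : ℕ) :
    (fun g : Equiv.Perm (Fin n) => if g = 1 then (1 : ℂ) else 0) ∈
    Submodule.span ℂ (spechtCoefficients n) := by
  classical
  by_contra hnot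
  obtain ⟨f, hf, hW⟩ := Submodule.exists_le_ker_of_notMem hnot
  have hfsum : ∀ F : Equiv.Perm (Fin n) → ℂ, f F = ∑ g, f (Pi.single g 1) * F g := by
    intro F
    conv_lhs => rw [pi_eq_sum_univ' F]
    rw [map_sum]
    refine Finset.sum_congr rfl fun g _ => ?_
    rw [map_smul, smul_eq_mul, mul_comm]
  have hker : ∀ (mu : YoungDiagram) (h : mu.card = n),
      ∑ g, f (Pi.single g 1) • spechtRepOfCard mu h g = 0 := by
    intro mu h
    refine LinearMap.ext fun v => Subtype.ext (funext fun r => ?_)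
    have h1 := hW (Submodule.subset_span ⟨mu, h, v, r ∘ Fin.cast h.symm, rfl⟩)
    rw [LinearMap.mem_ker, hfsum] at h1
    rw [LinearMap.sum_apply, AddSubmonoidClass.coe_finsetSum, Finset.sum_apply]
    refine (Finset.sum_congr rfl fun g _ => ?_).trans h1
    rw [LinearMap.smul_apply, ← spechtRepOfCard_apply]
    rfl
  have hchar : ∀ (mu : YoungDiagram) (h : mu.card = n), f (spechtRepOfCard mu h).character = 0 := by
    intro mu h
    have h1 := congrArg (LinearMap.trace ℂ _) (hker mu h)
    rw [map_sum, map_zero] at h1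
    rw [hfsum, ← h1]
    exact Finset.sum_congr rfl fun g _ => (map_smul (LinearMap.trace ℂ _) _ _).symm
  have hclass : ∀ F : ConjClasses (Equiv.Perm (Fin n)) → ℂ, f (fun g => F (ConjClasses.mk g)) = 0 := by
    intro F
    have hF : F ∈ Submodule.span ℂ (Set.range fun c : ConjClasses (Equiv.Perm (Fin n)) =>
        spechtClassCharacter (cycleDiagram c.out) (cycleDiagram_card c.out)) := by
      rw [span_spechtClassCharacter]
      trivial
    have hle : Submodule.span ℂ (Set.range fun c : ConjClasses (Equiv.Perm (Fin n)) =>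
        spechtClassCharacter (cycleDiagram c.out) (cycleDiagram_card c.out)) ≤
        LinearMap.ker (f ∘ₗ LinearMap.funLeft ℂ ℂ ConjClasses.mk) := by
      refine Submodule.span_le.2 ?_
      rintro _ ⟨c, rfl⟩
      exact hchar _ (cycleDiagram_card c.out)
    exact hle hF
  refine hf ?_
  refine (congrArg f (funext fun g => ?_)).trans
    (hclass fun c => if c = ConjClasses.mk 1 then 1 else 0)
  refine if_congr ?_ rfl rfl
  rw [ConjClasses.mk_eq_mk_iff_isConj, isConj_comm, isConj_one_right]

theorem exists_sum_spechtCoefficients (n : ℕ) : ∃ (N : ℕ) (mu : Fin N → YoungDiagram)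
    (h : ∀ j, (mu j).card = n) (v : ∀ j, specht (mu j)) (r : Fin N → Fin n → ℕ),
    ∀ g : Equiv.Perm (Fin n),
      ∑ j, (v j).1 (r j ∘ g ∘ Fin.cast (h j)) = if g = 1 then 1 else 0 := by
  obtain ⟨N, c, F, hF⟩ := Submodule.mem_span_set'.1 (delta_mem_span_spechtCoefficients n)
  choose mu h v r hr using fun j => (F j).2
  -- The scalars are absorbed into the Specht vectors.
  refine ⟨N, mu, h, fun j => c j • v j, r, fun g => ?_⟩
  rw [← congrFun hF g, Finset.sum_apply]
  refine Finset.sum_congr rfl fun j _ => ?_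
  rw [Pi.smul_apply, hr j]
  rfl

/-! ### Coordinates on the tensor spaces -/

/-- `j` indexes a basis vector of the block `V_i`. -/
def InBlock {ℓ : ℕ} (k : Fin ℓ → ℕ) (i : Fin ℓ) (j : Fin (∑ m, k m)) : Prop :=
  ∑ m ∈ Finset.Iio i, k m ≤ (j : ℕ) ∧ (j : ℕ) < ∑ m ∈ Finset.Iic i, k m

theorem sum_Iic_eq_sum_Iio_add {ℓ : ℕ} (k : Fin ℓ → ℕ) (i : Fin ℓ) :
    ∑ m ∈ Finset.Iic i, k m = ∑ m ∈ Finset.Iio i, k m + k i := by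
  rw [← Finset.Iio_insert, Finset.sum_insert (by simp), add_comm]

theorem blockSpace_apply_eq_zero {ℓ : ℕ} {k : Fin ℓ → ℕ} {i : Fin ℓ}
    {w : Fin (∑ m, k m) → ℂ} (hw : w ∈ blockSpace k i) {j : Fin (∑ m, k m)}
    (hj : ¬ InBlock k i j) : w j = 0 := by
  suffices blockSpace k i ≤ LinearMap.ker (LinearMap.proj (R := ℂ) (φ := fun _ => ℂ) j) from
    this hw
  refine Submodule.span_le.2 ?_
  rintro _ ⟨j', h1, h2, rfl⟩
  refine Pi.single_eq_of_ne (M := fun _ => ℂ) (fun h => hj ?_) 1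
  subst h
  exact ⟨h1, h2⟩

open Classical in
/-- The basis vector `v_j` of the block `V_i`, or zero if `j` does not belong to this block. -/
def blockVec {ℓ : ℕ} (k : Fin ℓ → ℕ) (i : Fin ℓ) (j : Fin (∑ m, k m)) : blockSpace k i :=
  if h : InBlock k i j then ⟨Pi.single j 1, Submodule.subset_span ⟨j, h.1, h.2, rfl⟩⟩ else 0

theorem blockVec_apply {ℓ : ℕ} {k : Fin ℓ → ℕ} {i : Fin ℓ} {j : Fin (∑ m, k m)}
    (h : InBlock k i j) (j' : Fin (∑ m, k m)) :
    (blockVec k i j').1 j = if j' = j then 1 else 0 := by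
  rw [blockVec]
  split_ifs with h1 h2 h2
  · subst h2
    exact Pi.single_eq_same (M := fun _ => ℂ) _ _
  · exact Pi.single_eq_of_ne (M := fun _ => ℂ) (Ne.symm h2) 1
  · subst h2
    exact absurd h h1
  · rfl

theorem sum_smul_blockVec {ℓ : ℕ} {k : Fin ℓ → ℕ} {i : Fin ℓ} (w : blockSpace k i) :
    ∑ j, w.1 j • blockVec k i j = w := by
  refine Subtype.ext (funext fun j => ?_)
  rw [AddSubmonoidClass.coe_finsetSum, Finset.sum_apply]
  by_cases hj : InBlock k i j
  · rw [Finset.sum_congr rfl fun j' _ => (show (w.1 j' • blockVec k i j').1 j =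
      w.1 j' * if j' = j then 1 else 0 by rw [← blockVec_apply hj]; rfl)]
    simp
  · rw [blockSpace_apply_eq_zero w.2 hj]
    exact Finset.sum_eq_zero fun j' _ =>
      blockSpace_apply_eq_zero (w.1 j' • blockVec k i j').2 hj

/-- The coefficient of the basis tensor `v_{r 1} ⊗ ⋯ ⊗ v_{r d}`. -/
def tensorCoord {ℓ d : ℕ} (k : Fin ℓ → ℕ) (f : Coloring ℓ d) (r : Fin d → Fin (∑ m, k m)) :
    TensorSpace k f →ₗ[ℂ] ℂ :=
  PiTensorProduct.lift ((MultilinearMap.mkPiAlgebra ℂ (Fin d) ℂ).compLinearMap fun x =>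
    (LinearMap.proj (r x)).comp (blockSpace k (f.color x)).subtype)

theorem tensorCoord_tprod {ℓ d : ℕ} (k : Fin ℓ → ℕ) (f : Coloring ℓ d)
    (r : Fin d → Fin (∑ m, k m)) (w : ∀ x, blockSpace k (f.color x)) :
    tensorCoord k f r (PiTensorProduct.tprod ℂ w) = ∏ x, (w x).1 (r x) := by
  rw [tensorCoord, PiTensorProduct.lift.tprod]
  rfl

theorem sum_tensorCoord_smul {ℓ d : ℕ} {k : Fin ℓ → ℕ} {f : Coloring ℓ d} (u : TensorSpace k f) :
    ∑ r : Fin d → Fin (∑ m, k m), tensorCoord k f r u •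
      PiTensorProduct.tprod ℂ (fun x => blockVec k (f.color x) (r x)) = u := by
  induction u using PiTensorProduct.induction_on with
  | smul_tprod c w =>
    conv_rhs => rw [← funext fun x => sum_smul_blockVec (w x), MultilinearMap.map_sum,
      Finset.smul_sum]
    refine Finset.sum_congr rfl fun r _ => ?_
    rw [MultilinearMap.map_smul_univ, map_smul, tensorCoord_tprod, smul_eq_mul, mul_smul]
  | add u v hu hv =>
    conv_rhs => rw [← hu, ← hv]
    rw [← Finset.sum_add_distrib]
    exact Finset.sum_congr rfl fun r _ => by rw [map_add, add_smul]

theorem tensorSpace_ext {ℓ d : ℕ} {k : Fin ℓ → ℕ} {f : Coloring ℓ d} {u : TensorSpace k f}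
    (h : ∀ r, tensorCoord k f r u = 0) : u = 0 := by
  rw [← sum_tensorCoord_smul u]
  exact Finset.sum_eq_zero fun r _ => by rw [h, zero_smul]

theorem tensorCoord_eq_zero {ℓ d : ℕ} {k : Fin ℓ → ℕ} {f : Coloring ℓ d}
    {r : Fin d → Fin (∑ m, k m)} {x : Fin d} (hx : ¬ InBlock k (f.color x) (r x)) :
    tensorCoord k f r = 0 := by
  refine PiTensorProduct.ext (MultilinearMap.ext fun w => ?_)
  change tensorCoord k f r (PiTensorProduct.tprod ℂ w) = 0
  rw [tensorCoord_tprod]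
  exact Finset.prod_eq_zero (Finset.mem_univ x) (blockSpace_apply_eq_zero (w x).2 hx)

/-- Coordinates can be prescribed only at index functions respecting the blocks; all others vanish
identically. -/
theorem exists_tensorCoord_eq {ℓ d : ℕ} (k : Fin ℓ → ℕ) (f : Coloring ℓ d)
    (F : (Fin d → Fin (∑ m, k m)) → ℂ) :
    ∃ u, ∀ r, (∀ x, InBlock k (f.color x) (r x)) → tensorCoord k f r u = F r := by
  refine ⟨∑ s, F s • PiTensorProduct.tprod ℂ (fun x => blockVec k (f.color x) (s x)),
    fun r hr => ?_⟩
  rw [map_sum, Finset.sum_eq_single r]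
  · rw [map_smul, tensorCoord_tprod,
      Finset.prod_eq_one fun x _ => by rw [blockVec_apply (hr x), if_pos rfl], smul_eq_mul, mul_one]
  · intro s _ hs
    obtain ⟨x, hx⟩ := Function.ne_iff.1 hs
    rw [map_smul, tensorCoord_tprod, Finset.prod_eq_zero (Finset.mem_univ x), smul_zero]
    rw [blockVec_apply (hr x), if_neg hx]
  · exact fun h => absurd (Finset.mem_univ _) h

theorem tensorCoord_tensorMap {ℓ d : ℕ} {k : Fin ℓ → ℕ} {f g : Coloring ℓ d} (σ : f ⟶ g)
    (r : Fin d → Fin (∑ m, k m)) (u : TensorSpace k f) :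
    tensorCoord k g r (tensorMap k σ u) = tensorCoord k f (r ∘ Coloring.perm σ) u := by
  suffices (tensorCoord k g r).comp (tensorMap k σ) = tensorCoord k f (r ∘ Coloring.perm σ) from
    LinearMap.congr_fun this u
  refine PiTensorProduct.ext (MultilinearMap.ext fun w => ?_)
  change tensorCoord k g r (tensorMap k σ (PiTensorProduct.tprod ℂ w)) =
    tensorCoord k f (r ∘ Coloring.perm σ) (PiTensorProduct.tprod ℂ w)
  rw [tensorMap_tprod, tensorCoord_tprod, tensorCoord_tprod]
  refine Fintype.prod_equiv (Coloring.perm σ).symm _ _ fun x => ?_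
  rw [Function.comp_apply, Equiv.apply_symm_apply]

/-! ### Linear extensions of functors -/

/-- The linear map given by the action of a linear combination of morphisms of `C`. -/
def linExtendMap {C : Type} [Category.{0} C] (F : C ⥤ ModuleCat.{0} ℂ) {X Y : C}
    (a : (X ⟶ Y) →₀ ℂ) : F.obj X →ₗ[ℂ] F.obj Y :=
  ((linExtend F).map (X := X) (Y := Y) a).hom

theorem linExtendMap_apply {C : Type} [Category.{0} C] (F : C ⥤ ModuleCat.{0} ℂ) {X Y : C}
    (a : (X ⟶ Y) →₀ ℂ) (u : F.obj X) :
    linExtendMap F a u = a.sum fun σ c => c • (F.map σ).hom u := by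
  change (a.sum fun σ c => c • F.map σ : F.obj X ⟶ F.obj Y).hom u = _
  rw [Finsupp.sum, ModuleCat.hom_sum, LinearMap.sum_apply]
  rfl

theorem linExtendMap_functional {C : Type} [Category.{0} C] (F : C ⥤ ModuleCat.{0} ℂ) {X Y : C}
    (a : (X ⟶ Y) →₀ ℂ) (u : F.obj X) (ξ : F.obj Y →ₗ[ℂ] ℂ) :
    ξ (linExtendMap F a u) = a.sum fun σ c => c * ξ ((F.map σ).hom u) := by
  rw [linExtendMap_apply, Finsupp.sum, map_sum]
  exact Finset.sum_congr rfl fun σ _ => map_smul ξ _ _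

/-- Here `s` records positions inside the blocks. The coordinate at `j` of σu is the coordinate of
`u` at `j ∘ σ`, and `u` may be chosen with coordinates given by `F`, so the sum is a coordinate of a
u = 0. -/
theorem sum_eq_zero_of_linExtendMap_eq_zero {ℓ d : ℕ} {k : Fin ℓ → ℕ} {X Y : Coloring ℓ d}
    {a : (X ⟶ Y) →₀ ℂ} (ha : linExtendMap (groupoidTensor k d) a = 0) {s : Fin d → ℕ}
    (hs : ∀ y, s y < k (Y.color y)) (F : (Fin d → ℕ) → ℂ) :
    (a.sum fun σ c => c * F (s ∘ Coloring.perm σ)) = 0 := by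
  let off : Fin ℓ → ℕ := fun i => ∑ m ∈ Finset.Iio i, k m
  have hoff : ∀ i, off i + k i ≤ ∑ m, k m := by
    intro i
    rw [← sum_Iic_eq_sum_Iio_add]
    exact Finset.sum_le_sum_of_subset (Finset.subset_univ _)
  let j : Fin d → Fin (∑ m, k m) := fun y =>
    ⟨off (Y.color y) + s y, lt_of_lt_of_le (Nat.add_lt_add_left (hs y) _) (hoff _)⟩
  -- Subtracting the block offset undoes the shift in `j`, because σ preserves colours.
  obtain ⟨u, hu⟩ := exists_tensorCoord_eq k X fun r => F fun x => (r x : ℕ) - off (X.color x)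
  have h2 : (a.sum fun σ c => c * tensorCoord k Y j (tensorMap k σ u)) = 0 :=
    (linExtendMap_functional (groupoidTensor k d) a u (tensorCoord k Y j)).symm.trans
      ((congrArg (tensorCoord k Y j) (LinearMap.congr_fun ha u)).trans (map_zero _))
  rw [← h2]
  refine Finset.sum_congr rfl fun σ _ => ?_
  dsimp only
  congr 1
  refine Eq.trans ?_ (tensorCoord_tensorMap σ j u).symm
  have hc := Coloring.color_perm σ
  rw [hu]
  · congr 1
    funext x
    simp only [Function.comp_apply, j, hc, Nat.add_sub_cancel_left]
  · intro x
    refine ⟨?_, ?_⟩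
    · simp [j, hc, off]
    · rw [sum_Iic_eq_sum_Iio_add, ← hc]
      exact Nat.add_lt_add_left (hs _) _

/-! ### Homomorphisms to representable modules -/

instance Coloring.hom_finite {ℓ d : ℕ} (f g : Coloring ℓ d) : Finite (f ⟶ g) :=
  inferInstanceAs (Finite {σ : Equiv.Perm (Fin d) // g.color ∘ σ = f.color})

instance Coloring.hom_fintype {ℓ d : ℕ} (f g : Coloring ℓ d) : Fintype (f ⟶ g) :=
  Fintype.ofFinite _

/-- The inverse of a morphism of colourings. -/
def Coloring.homInv {ℓ d : ℕ} {f g : Coloring ℓ d} (σ : f ⟶ g) : g ⟶ f :=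
  ⟨(Coloring.perm σ).symm, by
    funext x
    have := Coloring.color_perm σ ((Coloring.perm σ).symm x)
    rw [Equiv.apply_symm_apply] at this
    exact this.symm⟩

theorem Coloring.hom_ext {ℓ d : ℕ} {f g : Coloring ℓ d} {σ τ : f ⟶ g}
    (h : ∀ x, Coloring.perm σ x = Coloring.perm τ x) : σ = τ :=
  Subtype.ext (Equiv.ext h)

theorem Coloring.comp_homInv {ℓ d : ℕ} {f g : Coloring ℓ d} (σ : f ⟶ g) :
    σ ≫ Coloring.homInv σ = 𝟙 f :=
  Coloring.hom_ext fun x => Equiv.symm_apply_apply (Coloring.perm σ) x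

theorem Coloring.homInv_comp {ℓ d : ℕ} {f g : Coloring ℓ d} (σ : f ⟶ g) :
    Coloring.homInv σ ≫ σ = 𝟙 g :=
  Coloring.hom_ext fun x => Equiv.apply_symm_apply (Coloring.perm σ) x

theorem Coloring.homInv_comp_homInv {ℓ d : ℕ} {f g h : Coloring ℓ d} (σ : f ⟶ h) (τ : g ⟶ h) :
    Coloring.homInv (σ ≫ Coloring.homInv τ) = τ ≫ Coloring.homInv σ := rfl

theorem Coloring.comp_homInv_eq_id_iff {ℓ d : ℕ} {f g : Coloring ℓ d} (σ τ : f ⟶ g) :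
    σ ≫ Coloring.homInv τ = 𝟙 f ↔ σ = τ := by
  constructor
  · intro h
    rw [← Category.comp_id σ, ← Coloring.homInv_comp τ, ← Category.assoc, h, Category.id_comp]
  · rintro rfl
    exact Coloring.comp_homInv σ

/-- The linear map underlying `coeffHom`: a vector `v` is sent to the function
`τ ↦ ξ (τ⁻¹ v)`. -/
def coeffMap {ℓ d : ℕ} (F : Coloring ℓ d ⥤ ModuleCat.{0} ℂ) {X : Coloring ℓ d}
    (ξ : F.obj X →ₗ[ℂ] ℂ) (Z : Coloring ℓ d) : F.obj Z →ₗ[ℂ] ((X ⟶ Z) →₀ ℂ) :=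
  (Finsupp.linearEquivFunOnFinite ℂ ℂ (X ⟶ Z)).symm.toLinearMap.comp
    (LinearMap.pi fun τ => ξ.comp (F.map (Coloring.homInv τ)).hom)

theorem coeffMap_apply {ℓ d : ℕ} (F : Coloring ℓ d ⥤ ModuleCat.{0} ℂ) {X : Coloring ℓ d}
    (ξ : F.obj X →ₗ[ℂ] ℂ) (Z : Coloring ℓ d) (v : F.obj Z) (τ : X ⟶ Z) :
    coeffMap F ξ Z v τ = ξ ((F.map (Coloring.homInv τ)).hom v) := rfl

/-- The composition of linear combinations of morphisms. -/
def Coloring.freeComp {ℓ d : ℕ} {X Z W : Coloring ℓ d} (b : (X ⟶ Z) →₀ ℂ) (a : (Z ⟶ W) →₀ ℂ) :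
    (X ⟶ W) →₀ ℂ :=
  CategoryStruct.comp (obj := LinColoring ℓ d) (X := X) (Y := Z) (Z := W) b a

theorem Coloring.freeComp_eq_sum {ℓ d : ℕ} {X Z W : Coloring ℓ d} (b : (X ⟶ Z) →₀ ℂ)
    (a : (Z ⟶ W) →₀ ℂ) : Coloring.freeComp b a =
      b.sum fun f' s => a.sum fun g' t => Finsupp.single (f' ≫ g') (s * t) := rfl

theorem Coloring.freeComp_apply {ℓ d : ℕ} {X Z W : Coloring ℓ d} (b : (X ⟶ Z) →₀ ℂ)
    (a : (Z ⟶ W) →₀ ℂ) (σ : X ⟶ W) :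
    Coloring.freeComp b a σ = a.sum fun τ c => c * b (σ ≫ Coloring.homInv τ) := by
  classical
  have h1 : ∀ (f' : X ⟶ Z) (g' : Z ⟶ W), f' ≫ g' = σ ↔ f' = σ ≫ Coloring.homInv g' := by
    intro f' g'
    constructor
    · rintro rfl
      rw [Category.assoc, Coloring.comp_homInv, Category.comp_id]
    · rintro rfl
      rw [Category.assoc, Coloring.homInv_comp, Category.comp_id]
  rw [Coloring.freeComp_eq_sum, Finsupp.sum_fintype _ _ (by simp), Finsupp.finsetSum_apply,
    Finsupp.sum]
  simp_rw [Finsupp.sum, Finsupp.finsetSum_apply, Finsupp.single_apply, h1]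
  rw [Finset.sum_comm]
  refine Finset.sum_congr rfl fun τ _ => ?_
  rw [Finset.sum_ite_eq' Finset.univ, if_pos (Finset.mem_univ _), mul_comm]

/-- This is the naturality of `coeffHom`: σ⁻¹ ∘ τ is the inverse of τ⁻¹ ∘ σ, so both sides are the
same convolution. -/
theorem coeffMap_linExtendMap {ℓ d : ℕ} (F : Coloring ℓ d ⥤ ModuleCat.{0} ℂ) {X Z W : Coloring ℓ d}
    (ξ : F.obj X →ₗ[ℂ] ℂ) (b : (Z ⟶ W) →₀ ℂ) (v : F.obj Z) :
    coeffMap F ξ W (linExtendMap F b v) = Coloring.freeComp (coeffMap F ξ Z v) b := by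
  refine Finsupp.ext fun σ => ?_
  rw [coeffMap_apply, Coloring.freeComp_apply]
  refine (linExtendMap_functional F b v (ξ.comp (F.map (Coloring.homInv σ)).hom)).trans ?_
  refine Finsupp.sum_congr fun τ _ => ?_
  rw [coeffMap_apply, Coloring.homInv_comp_homInv, F.map_comp]
  rfl

/-- The homomorphism of `ℂ𝒢`-modules from the linear extension of `F` to the representable module
at `X` given by a linear functional on `F(X)`. -/
def coeffHom {ℓ d : ℕ} (F : Coloring ℓ d ⥤ ModuleCat.{0} ℂ) {X : Coloring ℓ d}
    (ξ : F.obj X →ₗ[ℂ] ℂ) :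
    linExtend F ⟶ (linearCoyoneda ℂ (LinColoring ℓ d)).obj (Opposite.op X) where
  app Z := ModuleCat.ofHom (coeffMap F ξ Z)
  naturality {_ _} b := by
    apply ModuleCat.hom_ext
    exact LinearMap.ext fun v => coeffMap_linExtendMap F ξ b v

theorem coeffMap_linExtendMap_apply {ℓ d : ℕ} (F : Coloring ℓ d ⥤ ModuleCat.{0} ℂ)
    {X Y : Coloring ℓ d} (ξ : F.obj X →ₗ[ℂ] ℂ) (a : (X ⟶ Y) →₀ ℂ) (v : F.obj X) (τ : X ⟶ Y) :
    coeffMap F ξ Y (linExtendMap F a v) τ =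
      a.sum fun σ c => c * ξ ((F.map (σ ≫ Coloring.homInv τ)).hom v) := by
  rw [coeffMap_apply]
  refine (linExtendMap_functional F a v (ξ.comp (F.map (Coloring.homInv τ)).hom)).trans ?_
  refine Finsupp.sum_congr fun σ _ => ?_
  rw [F.map_comp]
  rfl

open Classical in
-- The coefficient of the right side at τ is the sum over σ of `a σ` times the delta function at τ⁻¹
-- ∘ σ, which selects σ = τ.
theorem eq_sum_coeffMap {ℓ d : ℕ} {J : Type*} [Fintype J] {X Y : Coloring ℓ d}
    (F : J → Coloring ℓ d ⥤ ModuleCat.{0} ℂ) (ξ : ∀ j, (F j).obj X →ₗ[ℂ] ℂ)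
    (v : ∀ j, (F j).obj X)
    (h : ∀ π : X ⟶ X, ∑ j, ξ j (((F j).map π).hom (v j)) = if π = 𝟙 X then 1 else 0)
    (a : (X ⟶ Y) →₀ ℂ) :
    a = ∑ j, coeffMap (F j) (ξ j) Y (linExtendMap (F j) a (v j)) := by
  refine Finsupp.ext fun τ => ?_
  rw [Finsupp.finsetSum_apply]
  simp_rw [coeffMap_linExtendMap_apply]
  simp_rw [Finsupp.sum]
  rw [Finset.sum_comm]
  simp_rw [← Finset.mul_sum, h, Coloring.comp_homInv_eq_id_iff]
  simp

/-! ### Matrix coefficients of the modules `L_p` -/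

/-- The order preserving identification of `{1, …, lam i}` with the points of colour `i`. -/
def Coloring.enumFiber {ℓ d : ℕ} {lam : Fin ℓ → ℕ} (f : Coloring ℓ d) (hf : f.type = lam)
    (i : Fin ℓ) : Fin (lam i) ≃ f.Fiber i :=
  (Fintype.orderIsoFinOfCardEq (f.Fiber i) (congrFun hf i)).toEquiv

theorem Coloring.enumFiber_toYoung {ℓ d : ℕ} {lam : Fin ℓ → ℕ} {f g : Coloring ℓ d} (σ : f ⟶ g)
    (hf : f.type = lam) (hg : g.type = lam) (i : Fin ℓ) (y : Fin (lam i)) :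
    (g.enumFiber hg i (Coloring.toYoung σ hf hg i y)).1 =
      Coloring.perm σ (f.enumFiber hf i y).1 := by
  rw [Coloring.enumFiber, Coloring.toYoung, Equiv.trans_apply, Equiv.apply_symm_apply]
  rfl

theorem Coloring.enumFiber_cast {ℓ d : ℕ} {lam : Fin ℓ → ℕ} (f : Coloring ℓ d) (hf : f.type = lam)
    (i : Fin ℓ) (y : Fin (lam i)) :
    f.enumFiber hf i y = f.enumFiber rfl i (Fin.cast (congrFun hf i).symm y) := by
  subst hf
  rfl

theorem Coloring.toYoung_eq_one_iff {ℓ d : ℕ} {lam : Fin ℓ → ℕ} {f : Coloring ℓ d} (σ : f ⟶ f)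
    (hf : f.type = lam) : (∀ i, Coloring.toYoung σ hf hf i = 1) ↔ σ = 𝟙 f := by
  constructor
  · intro h
    refine Coloring.hom_ext fun x => ?_
    have h1 := Coloring.enumFiber_toYoung σ hf hf (f.color x)
      ((f.enumFiber hf (f.color x)).symm ⟨x, rfl⟩)
    rw [h, Equiv.Perm.one_apply, Equiv.apply_symm_apply] at h1
    exact h1.symm
  · rintro rfl i
    rw [Coloring.toYoung_id]
    rfl

/-- The product of evaluations on the tensor product of the Specht modules. -/
def multiSpechtEval {ℓ d : ℕ} (p : MultiPartition ℓ d) (q : ∀ i, Fin (p.shape i) → ℕ) :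
    MultiSpecht p →ₗ[ℂ] ℂ :=
  PiTensorProduct.lift ((MultilinearMap.mkPiAlgebra ℂ (Fin ℓ) ℂ).compLinearMap fun i =>
    (LinearMap.proj (R := ℂ) (φ := fun _ => ℂ) (q i)).comp (specht (p.part i)).subtype)

theorem multiSpechtEval_tprod {ℓ d : ℕ} (p : MultiPartition ℓ d) (q : ∀ i, Fin (p.shape i) → ℕ)
    (v : ∀ i, specht (p.part i)) :
    multiSpechtEval p q (PiTensorProduct.tprod ℂ v) = ∏ i, (v i).1 (q i) := by
  rw [multiSpechtEval, PiTensorProduct.lift.tprod]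
  rfl

/-- The identification of `𝒮_p` with `L_p(f)`, or the zero map if the type of `f` is not `p`. -/
def toGroupoidModule {ℓ d : ℕ} (p : MultiPartition ℓ d) (f : Coloring ℓ d) :
    MultiSpecht p →ₗ[ℂ] (groupoidModule p).obj f :=
  LinearMap.pi fun _ => LinearMap.id

theorem groupoidModule_map_toGroupoidModule {ℓ d : ℕ} (p : MultiPartition ℓ d) {f g : Coloring ℓ d}
    (σ : f ⟶ g) (hf : f.type = p.shape) (hg : g.type = p.shape) (m : MultiSpecht p) :
    ((groupoidModule p).map σ).hom (toGroupoidModule p f m) =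
      toGroupoidModule p g (multiSpechtRep p (Coloring.toYoung σ hf hg) m) := rfl

/-- The evaluation on `L_p(f)` at the functions obtained by restricting `R` to the sets of points
of each colour. -/
def colorEval {ℓ d : ℕ} (p : MultiPartition ℓ d) {f : Coloring ℓ d} (hf : f.type = p.shape)
    (R : Fin d → ℕ) : (groupoidModule p).obj f →ₗ[ℂ] ℂ :=
  (multiSpechtEval p fun i y => R (f.enumFiber hf i y).1).comp
    (LinearMap.proj (φ := fun _ => MultiSpecht p) (PLift.up hf))

theorem colorEval_map_tprod {ℓ d : ℕ} (p : MultiPartition ℓ d) {f g : Coloring ℓ d}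
    (hf : f.type = p.shape) (hg : g.type = p.shape) (R : Fin d → ℕ)
    (σ : f ⟶ g) (v : ∀ i, specht (p.part i)) :
    colorEval p hg R (((groupoidModule p).map σ).hom
      (toGroupoidModule p f (PiTensorProduct.tprod ℂ v))) =
      ∏ i, (v i).1 fun y => R (Coloring.perm σ (f.enumFiber hf i y).1) := by
  rw [groupoidModule_map_toGroupoidModule p σ hf hg, multiSpechtRep_tprod]
  refine (multiSpechtEval_tprod p _ _).trans ?_
  exact Finset.prod_congr rfl fun i _ => congrArg (v i).1 (funext fun y =>
    congrArg R (Coloring.enumFiber_toYoung σ hf hg i y))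

/-- Polytabloids are supported on rearrangements of tabloids, whose values are row indices of `mu`.
-/
theorem apply_eq_zero_of_mem_specht {mu : YoungDiagram} {v : (Fin mu.card → ℕ) → ℂ}
    (hv : v ∈ specht mu) {r : Fin mu.card → ℕ} {y : Fin mu.card}
    (hy : mu.rowLens.length ≤ r y) : v r = 0 := by
  suffices specht mu ≤ LinearMap.ker (LinearMap.proj (R := ℂ) (φ := fun _ => ℂ) r) from this hv
  refine Submodule.span_le.2 ?_
  rintro _ ⟨t, rfl⟩
  refine t.polytabloid_eq_zero r fun π h => ?_
  have h1 := congrFun h (π.symm y)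
  rw [Function.comp_apply, Equiv.apply_symm_apply] at h1
  rw [h1, YoungDiagram.length_rowLens] at hy
  have h2 := (YoungDiagram.mem_cells _).1 (t (π.symm y)).2
  have h3 := YoungDiagram.mem_iff_lt_colLen.1
    (mu.up_left_mem le_rfl (Nat.zero_le _) h2 : ((t (π.symm y)).1.1, 0) ∈ mu)
  exact absurd h3 (not_lt.2 hy)

open Classical in
-- An automorphism of X is a tuple of permutations, one for each colour, so its delta function is
-- the product of those of the symmetric groups. Expanding the product of sums gives one
-- multi-partition for each choice of a summand in every colour.
theorem exists_sum_colorEval {ℓ d : ℕ} (X : Coloring ℓ d) :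
    ∃ (J : Type) (_ : Fintype J) (p : J → MultiPartition ℓ d) (hp : ∀ j, X.type = (p j).shape)
      (v : ∀ j i, specht ((p j).part i)) (R : J → Fin d → ℕ), ∀ π : X ⟶ X,
      ∑ j, colorEval (p j) (hp j) (R j) (((groupoidModule (p j)).map π).hom
        (toGroupoidModule (p j) X (PiTensorProduct.tprod ℂ (v j)))) =
        if π = 𝟙 X then 1 else 0 := by
  choose N mu h v r hr using fun i => exists_sum_spechtCoefficients (X.type i)
  have hsum : ∑ i, X.type i = d := by
    have h1 := Fintype.card_congr (Equiv.sigmaFiberEquiv X.color)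
    rw [Fintype.card_sigma, Fintype.card_fin] at h1
    exact h1
  refine ⟨∀ i, Fin (N i), inferInstance,
    fun j => ⟨fun i => mu i (j i), by rw [← hsum]; exact Finset.sum_congr rfl fun i _ => h i (j i)⟩,
    fun j => funext fun i => (h i (j i)).symm, fun j i => v i (j i),
    -- The evaluation points of the separate colours are glued to one function on all points.
    fun j x => r (X.color x) (j (X.color x)) ((X.enumFiber rfl (X.color x)).symm ⟨x, rfl⟩),
    fun π => ?_⟩
  have hprod : ∏ i, ∑ j : Fin (N i),
      (v i j).1 (r i j ∘ Coloring.toYoung π rfl rfl i ∘ Fin.cast (h i j)) =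
      if π = 𝟙 X then 1 else 0 := by
    rw [Finset.prod_congr rfl fun i _ => hr i (Coloring.toYoung π rfl rfl i)]
    by_cases hπ : π = 𝟙 X
    · rw [if_pos hπ]
      exact Finset.prod_eq_one fun i _ =>
        if_pos ((Coloring.toYoung_eq_one_iff π rfl).2 hπ i)
    · rw [if_neg hπ]
      have h1 := mt (Coloring.toYoung_eq_one_iff π rfl).1 hπ
      push Not at h1
      obtain ⟨i, hi⟩ := h1
      exact Finset.prod_eq_zero (Finset.mem_univ i) (if_neg hi)
  rw [← hprod, Finset.prod_univ_sum, Fintype.piFinset_univ]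
  refine Finset.sum_congr rfl fun j _ => ?_
  rw [colorEval_map_tprod _ (funext fun i => (h i (j i)).symm)]
  refine Finset.prod_congr rfl fun i _ => congrArg (v i (j i)).1 (funext fun y => ?_)
  -- Quantifying over the fibre allows `i` to be replaced by the colour of `z`, which removes the
  -- dependence of types on that equality.
  have hz : ∀ (z : X.Fiber i),
      r (X.color z.1) (j (X.color z.1)) ((X.enumFiber rfl (X.color z.1)).symm ⟨z.1, rfl⟩) =
        r i (j i) ((X.enumFiber rfl i).symm z) := by
    rintro ⟨z, rfl⟩
    rfl
  rw [Coloring.enumFiber_cast, ← Coloring.enumFiber_toYoung π rfl rfl]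
  refine (hz _).trans ?_
  rw [Equiv.symm_apply_apply]
  rfl

theorem mem_moduleIdeal_of_linExtendMap_eq_zero {ℓ d : ℕ} (k : Fin ℓ → ℕ) {X Y : Coloring ℓ d}
    {a : (X ⟶ Y) →₀ ℂ} (ha : linExtendMap (groupoidTensor k d) a = 0) :
    a ∈ (moduleIdeal fun p : {p : MultiPartition ℓ d // ∃ i, k i < (p.part i).rowLens.length} =>
        simpleModule p.1).carrier X Y := by
  classical
  obtain ⟨J, _, p, hp, v, R, h⟩ := exists_sum_colorEval X
  rw [eq_sum_coeffMap (fun j => groupoidModule (p j)) (fun j => colorEval (p j) (hp j) (R j))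
    (fun j => toGroupoidModule (p j) X (PiTensorProduct.tprod ℂ (v j))) h a]
  refine Submodule.sum_mem _ fun j _ => ?_
  by_cases hj : ∃ i, k i < ((p j).part i).rowLens.length
  · exact Submodule.mem_iSup_of_mem ⟨p j, hj⟩ (Submodule.mem_iSup_of_mem
      (coeffHom (groupoidModule (p j)) (colorEval (p j) (hp j) (R j))) ⟨_, rfl⟩)
  · push Not at hj
    suffices hzero : coeffMap (groupoidModule (p j)) (colorEval (p j) (hp j) (R j)) Y
        (linExtendMap (groupoidModule (p j)) a
          (toGroupoidModule (p j) X (PiTensorProduct.tprod ℂ (v j)))) = 0 by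
      rw [hzero]
      exact Submodule.zero_mem _
    refine Finsupp.ext fun τ => ?_
    rw [coeffMap_linExtendMap_apply]
    simp_rw [colorEval_map_tprod (p j) (hp j) (hp j)]
    -- If R ∘ τ⁻¹ fits into the blocks, it indexes a basis tensor of G(Y), and the coefficient
    -- vanishes because `a` acts by zero.
    by_cases hs : ∀ y, R j ((Coloring.perm τ).symm y) < k (Y.color y)
    · exact sum_eq_zero_of_linExtendMap_eq_zero ha hs fun q => ∏ i, (v j i).1 fun y =>
        q (X.enumFiber (hp j) i y).1
    · push Not at hs
      obtain ⟨y, hy⟩ := hs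
      -- Otherwise a value is at least k_i, hence at least the number of rows of p_i. For every σ
      -- the factor of that colour is then evaluated outside the support of the Specht module.
      refine Finset.sum_eq_zero fun σ _ => mul_eq_zero_of_right _ ?_
      obtain ⟨x, rfl⟩ := (Coloring.perm σ).surjective y
      rw [Coloring.color_perm] at hy
      refine Finset.prod_eq_zero (Finset.mem_univ (X.color x))
        (apply_eq_zero_of_mem_specht (v j _).2
          (y := (X.enumFiber (hp j) _).symm ⟨x, rfl⟩) ((hj _).trans (hy.trans (le_of_eq ?_))))
      rw [Equiv.apply_symm_apply]
      rfl

/-! ### Homomorphic images of `L_p` act by zero if `p` has too many rows -/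

/-- The transposition of two points of the same colour. -/
def Coloring.swapHom {ℓ d : ℕ} {f : Coloring ℓ d} {x y : Fin d} (h : f.color x = f.color y) :
    f ⟶ f :=
  ⟨Equiv.swap x y, by
    funext z
    simp only [Function.comp_apply, Equiv.swap_apply_def]
    split_ifs with h1 h2
    · rw [h1, h]
    · rw [h2, h]
    · rfl⟩

theorem Coloring.perm_swapHom {ℓ d : ℕ} {f : Coloring ℓ d} {x y : Fin d}
    (h : f.color x = f.color y) : Coloring.perm (Coloring.swapHom h) = Equiv.swap x y := rfl

theorem Coloring.color_enumFiber {ℓ d : ℕ} {lam : Fin ℓ → ℕ} {f : Coloring ℓ d}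
    (hf : f.type = lam) (i : Fin ℓ) (a : Fin (lam i)) : f.color (f.enumFiber hf i a).1 = i :=
  (f.enumFiber hf i a).2

theorem Coloring.toYoung_swapHom {ℓ d : ℕ} {lam : Fin ℓ → ℕ} {f : Coloring ℓ d}
    (hf : f.type = lam) (i : Fin ℓ) (a b : Fin (lam i))
    (h : f.color (f.enumFiber hf i a).1 = f.color (f.enumFiber hf i b).1) :
    Coloring.toYoung (Coloring.swapHom h) hf hf = Pi.mulSingle i (Equiv.swap a b) := by
  have hinj : ∀ (j : Fin ℓ) (c c' : Fin (lam j)),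
      (f.enumFiber hf j c).1 = (f.enumFiber hf j c').1 ↔ c = c' := fun j c c' =>
    ⟨fun h => (f.enumFiber hf j).injective (Subtype.ext h), fun h => by rw [h]⟩
  funext j
  refine Equiv.ext fun c => (hinj j _ _).1 ?_
  rw [Coloring.enumFiber_toYoung, Coloring.perm_swapHom]
  by_cases hj : j = i
  · subst hj
    rw [Pi.mulSingle_eq_same, Equiv.swap_apply_def, Equiv.swap_apply_def]
    simp only [hinj]
    split_ifs <;> rfl
  · rw [Pi.mulSingle_eq_of_ne hj, Equiv.Perm.one_apply]
    have hne : ∀ a', (f.enumFiber hf j c).1 ≠ (f.enumFiber hf i a').1 := by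
      intro a' h'
      refine hj ?_
      rw [← Coloring.color_enumFiber hf j c, h', Coloring.color_enumFiber]
    exact Equiv.swap_apply_of_ne_of_ne (hne a) (hne b)

theorem multiSpechtRep_swap_tprod {ℓ d : ℕ} (p : MultiPartition ℓ d) (w : ∀ j, specht (p.part j))
    {i : Fin ℓ} {t : Tableau (p.part i)} (ht : (w i).1 = t.polytabloid) {a b : Fin (p.part i).card}
    (hab : a ≠ b) (hcol : (t a).1.2 = (t b).1.2) :
    multiSpechtRep p (Pi.mulSingle i (Equiv.swap a b)) (PiTensorProduct.tprod ℂ w) =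
      -PiTensorProduct.tprod ℂ w := by
  rw [multiSpechtRep_tprod]
  have h : (fun j => spechtRep (p.part j)
      ((Pi.mulSingle i (Equiv.swap a b) : ∀ j, Equiv.Perm (Fin (p.shape j))) j) (w j)) =
      Function.update w i ((-1 : ℂ) • w i) := by
    funext j
    by_cases hj : j = i
    · subst hj
      rw [Pi.mulSingle_eq_same, Function.update_self]
      refine Eq.trans ?_ (neg_one_smul ℂ (w j)).symm
      refine Subtype.ext ?_
      change rowRep _ (Equiv.swap a b) (w j).1 = -(w j).1
      rw [ht, t.rowRep_swap_polytabloid hab hcol]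
    · rw [Pi.mulSingle_eq_of_ne hj, Function.update_of_ne hj, map_one]
      rfl
  rw [h, MultilinearMap.map_update_smul, Function.update_eq_self]
  exact neg_one_smul ℂ (PiTensorProduct.tprod ℂ w)

/-- Pigeonhole: the first column has at least `k i + 1` cells, while the block has only `k i` basis
vectors. -/
theorem exists_column_pair {ℓ : ℕ} {k : Fin ℓ → ℕ} {i : Fin ℓ} {mu : YoungDiagram}
    (hmu : k i < mu.rowLens.length) (t : Tableau mu) (q : Fin mu.card → Fin (∑ m, k m))
    (hq : ∀ a, InBlock k i (q a)) : ∃ a b, a ≠ b ∧ (t a).1.2 = (t b).1.2 ∧ q a = q b := by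
  rw [YoungDiagram.length_rowLens] at hmu
  let cell : Fin (k i + 1) → mu.cells := fun c =>
    ⟨(c, 0), (YoungDiagram.mem_cells _).2 (YoungDiagram.mem_iff_lt_colLen.2
      (lt_of_le_of_lt (Nat.lt_succ_iff.1 c.2) hmu))⟩
  let pos : Fin (k i + 1) → Fin (k i) := fun c =>
    ⟨(q (t.symm (cell c)) : ℕ) - ∑ m ∈ Finset.Iio i, k m, by
      have h := hq (t.symm (cell c))
      rw [InBlock, sum_Iic_eq_sum_Iio_add] at h
      omega⟩
  obtain ⟨c, c', hne, hpos⟩ := Fintype.exists_ne_map_eq_of_card_lt pos (by simp)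
  refine ⟨t.symm (cell c), t.symm (cell c'), fun h => hne ?_, ?_, ?_⟩
  · have h1 := congrArg (fun z : mu.cells => z.1.1) (t.symm.injective h)
    exact Fin.ext h1
  · rw [Equiv.apply_symm_apply, Equiv.apply_symm_apply]
  · have h1 := (hq (t.symm (cell c))).1
    have h2 := (hq (t.symm (cell c'))).1
    have h3 : (q (t.symm (cell c)) : ℕ) - ∑ m ∈ Finset.Iio i, k m =
      (q (t.symm (cell c')) : ℕ) - ∑ m ∈ Finset.Iio i, k m := congrArg Fin.val hpos
    exact Fin.ext (by omega)

/-- With the other factors fixed, Φ is linear in the i-th one, which is spanned by polytabloids. -/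
theorem multiSpecht_hom_ext {ℓ d : ℕ} {p : MultiPartition ℓ d} (i : Fin ℓ)
    {Φ : MultiSpecht p →ₗ[ℂ] ℂ}
    (h : ∀ (w : ∀ j, specht (p.part j)) (t : Tableau (p.part i)), (w i).1 = t.polytabloid →
      Φ (PiTensorProduct.tprod ℂ w) = 0) : Φ = 0 := by
  refine PiTensorProduct.ext (MultilinearMap.ext fun w => ?_)
  let Λ : specht (p.part i) →ₗ[ℂ] ℂ :=
    (Φ.compMultilinearMap (PiTensorProduct.tprod ℂ)).toLinearMap w i
  have hΛ : specht (p.part i) ≤ (LinearMap.ker Λ).map (specht (p.part i)).subtype := by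
    refine Submodule.span_le.2 ?_
    rintro _ ⟨t, rfl⟩
    refine ⟨⟨t.polytabloid, Submodule.subset_span ⟨t, rfl⟩⟩, ?_, rfl⟩
    exact h _ t (by rw [Function.update_self])
  obtain ⟨v, hv, hvw⟩ := hΛ (w i).2
  have h1 : Λ (w i) = 0 := by
    rw [← Subtype.ext (a1 := v) hvw]
    exact hv
  have h2 : Λ (w i) = Φ (PiTensorProduct.tprod ℂ (Function.update w i (w i))) := rfl
  rw [h1, Function.update_eq_self] at h2
  exact h2.symm

/-- Two entries in one column of `t` have the same index under `r`. By equivariance their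
transposition changes the sign of the coordinate and also preserves it. -/
theorem tensorCoord_equivariant_eq_zero {ℓ d : ℕ} {k : Fin ℓ → ℕ} {p : MultiPartition ℓ d}
    {i : Fin ℓ} (hi : k i < (p.part i).rowLens.length) {f : Coloring ℓ d} (hf : f.type = p.shape)
    (Ψ : MultiSpecht p →ₗ[ℂ] TensorSpace k f)
    (hΨ : ∀ (σ : f ⟶ f) m, Ψ (multiSpechtRep p (Coloring.toYoung σ hf hf) m) =
      tensorMap k σ (Ψ m)) (r : Fin d → Fin (∑ m, k m)) (w : ∀ j, specht (p.part j))
    (t : Tableau (p.part i)) (ht : (w i).1 = t.polytabloid) :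
    tensorCoord k f r (Ψ (PiTensorProduct.tprod ℂ w)) = 0 := by
  by_cases hr : ∀ x, InBlock k (f.color x) (r x)
  · obtain ⟨a, b, hab, hcol, hrab⟩ := exists_column_pair hi t
      (fun a => r (f.enumFiber hf i a).1) fun a => by
        have := hr (f.enumFiber hf i a).1
        rwa [Coloring.color_enumFiber] at this
    have hcolor : f.color (f.enumFiber hf i a).1 = f.color (f.enumFiber hf i b).1 := by
      rw [Coloring.color_enumFiber, Coloring.color_enumFiber]
    have h1 := hΨ (Coloring.swapHom hcolor) (PiTensorProduct.tprod ℂ w)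
    rw [Coloring.toYoung_swapHom hf i a b hcolor, multiSpechtRep_swap_tprod p _ ht hab hcol,
      map_neg] at h1
    have h2 := congrArg (tensorCoord k f r) h1
    have h3 : r ∘ Coloring.perm (Coloring.swapHom hcolor) = r := by
      funext z
      rw [Coloring.perm_swapHom, Function.comp_apply, Equiv.swap_apply_def]
      split_ifs with h4 h5
      · rw [h4, hrab]
      · rw [h5, hrab]
      · rfl
    rw [tensorCoord_tensorMap, h3, map_neg] at h2
    exact neg_eq_self.1 h2
  · push Not at hr
    obtain ⟨x, hx⟩ := hr
    rw [tensorCoord_eq_zero hx, LinearMap.zero_apply]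

/-- A linear map from `𝒮_p` to a tensor space is zero if it is equivariant and some component of
`p` has too many rows. -/
theorem equivariant_eq_zero {ℓ d : ℕ} {k : Fin ℓ → ℕ} {p : MultiPartition ℓ d} {i : Fin ℓ}
    (hi : k i < (p.part i).rowLens.length) {f : Coloring ℓ d} (hf : f.type = p.shape)
    (Ψ : MultiSpecht p →ₗ[ℂ] TensorSpace k f)
    (hΨ : ∀ (σ : f ⟶ f) m, Ψ (multiSpechtRep p (Coloring.toYoung σ hf hf) m) =
      tensorMap k σ (Ψ m)) : Ψ = 0 := by
  refine LinearMap.ext fun m => tensorSpace_ext fun r => ?_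
  have h := multiSpecht_hom_ext i (Φ := (tensorCoord k f r).comp Ψ)
    (tensorCoord_equivariant_eq_zero hi hf Ψ hΨ r)
  exact LinearMap.congr_fun h m

theorem linExtendMap_freeComp {C : Type} [Category.{0} C] (F : C ⥤ ModuleCat.{0} ℂ) {X Y Z : C}
    (b : (X ⟶ Y) →₀ ℂ) (a : (Y ⟶ Z) →₀ ℂ) (u : F.obj X) :
    linExtendMap F (CategoryStruct.comp (obj := CategoryTheory.Free ℂ C)
      (X := X) (Y := Y) (Z := Z) b a) u = linExtendMap F a (linExtendMap F b u) :=
  congrArg (fun h : F.obj X ⟶ F.obj Z => h.hom u) ((linExtend F).map_comp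
    (X := X) (Y := Y) (Z := Z) b a)

theorem linExtendMap_single {C : Type} [Category.{0} C] (F : C ⥤ ModuleCat.{0} ℂ) {X Y : C}
    (σ : X ⟶ Y) (u : F.obj X) : linExtendMap F (Finsupp.single σ 1) u = (F.map σ).hom u := by
  rw [linExtendMap_apply, Finsupp.sum_single_index (by simp), one_smul]

/-- For fixed `u`, naturality of φ makes v ↦ φ(v) u equivariant under the automorphisms of Y, so
`equivariant_eq_zero` applies. If Y has another type, L_p(Y) is zero. -/
theorem linExtendMap_app_eq_zero {ℓ d : ℕ} (k : Fin ℓ → ℕ) {p : MultiPartition ℓ d} {i : Fin ℓ}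
    (hi : k i < (p.part i).rowLens.length) {X Y : Coloring ℓ d}
    (φ : simpleModule p ⟶ (linearCoyoneda ℂ (LinColoring ℓ d)).obj (Opposite.op X))
    (v : (groupoidModule p).obj Y) :
    linExtendMap (groupoidTensor k d) (show (X ⟶ Y) →₀ ℂ from (φ.app Y).hom v) = 0 := by
  by_cases hY : Y.type = p.shape
  · refine LinearMap.ext fun u => ?_
    let app : (groupoidModule p).obj Y →ₗ[ℂ] ((X ⟶ Y) →₀ ℂ) := (φ.app Y).hom
    let act : ((X ⟶ Y) →₀ ℂ) →ₗ[ℂ] TensorSpace k Y :=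
      { toFun := fun b => linExtendMap (groupoidTensor k d) b u
        map_add' := fun b b' => by
          have := (linExtend (groupoidTensor k d)).map_add (X := X) (Y := Y) (f := b) (g := b')
          exact congrArg (fun h : (groupoidTensor k d).obj X ⟶ (groupoidTensor k d).obj Y =>
            h.hom u) this
        map_smul' := fun c b => by
          have := (linExtend (groupoidTensor k d)).map_smul (X := X) (Y := Y) (r := c) b
          exact congrArg (fun h : (groupoidTensor k d).obj X ⟶ (groupoidTensor k d).obj Y =>
            h.hom u) this }
    have key := equivariant_eq_zero hi hY (act.comp (app.comp (toGroupoidModule p Y)))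
      fun σ m => by
        have h1 : app (linExtendMap (groupoidModule p) (Finsupp.single σ 1)
            (toGroupoidModule p Y m)) = CategoryStruct.comp (obj := LinColoring ℓ d)
            (X := X) (Y := Y) (Z := Y) (app (toGroupoidModule p Y m)) (Finsupp.single σ 1) :=
          congrArg (fun h => h.hom (toGroupoidModule p Y m))
            (φ.naturality (X := Y) (Y := Y) (Finsupp.single σ 1))
        rw [linExtendMap_single, groupoidModule_map_toGroupoidModule p σ hY hY] at h1
        have h2 := congrArg act h1
        refine h2.trans ((linExtendMap_freeComp (groupoidTensor k d) _ _ u).trans ?_)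
        exact linExtendMap_single (groupoidTensor k d) σ _
    have hv : v = toGroupoidModule p Y (v ⟨hY⟩) := rfl
    rw [hv]
    exact LinearMap.congr_fun key (v ⟨hY⟩)
  · have hv : v = 0 := funext fun h => absurd h.down hY
    have h0 : (show (X ⟶ Y) →₀ ℂ from (φ.app Y).hom v) = 0 := by
      rw [hv]
      exact map_zero (φ.app Y).hom
    rw [h0]
    refine LinearMap.ext fun u => ?_
    rw [linExtendMap_apply]
    rfl

theorem mem_kernelIdeal_iff {ℓ d : ℕ} (k : Fin ℓ → ℕ) {X Y : Coloring ℓ d} (a : (X ⟶ Y) →₀ ℂ) :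
    a ∈ (kernelIdeal (tensorModule k d)).carrier X Y ↔
      linExtendMap (groupoidTensor k d) a = 0 :=
  ⟨fun h => congrArg ModuleCat.Hom.hom h, fun h => ModuleCat.hom_ext h⟩

theorem lemma3p17 (ℓ d : ℕ) (hℓ : 0 < ℓ) (k : Fin ℓ → ℕ) (hk : ∀ i, 0 < k i) :
    kernelIdeal (tensorModule k d) =
      moduleIdeal fun p : {p : MultiPartition ℓ d // ∃ i, k i < (p.part i).rowLens.length} =>
        simpleModule p.1 := by
  refine LinIdeal.ext (funext fun X => funext fun Y => le_antisymm ?_ ?_)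
  · exact fun a ha =>
      mem_moduleIdeal_of_linExtendMap_eq_zero k ((mem_kernelIdeal_iff k a).1 ha)
  · refine iSup_le fun p => iSup_le fun φ => ?_
    rintro _ ⟨v, rfl⟩
    obtain ⟨i, hi⟩ := p.2
    exact (mem_kernelIdeal_iff k _).2 (linExtendMap_app_eq_zero k hi φ v)

end
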